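/- Let $Q_d$ denote the $d$-dimensional hypercube. The distance between two edges $e,e'$ of a graph is the number of edges in a shortest path between an endpoint of $e$ and an endpoint of $e'$; the $t$-neighborhood of an edge $e$ is the subgraph formed by all edges at distance at most $t$ from $e$; a distance-$t$ matching is a matching in which any two distinct edges are at distance at least $t$. A dimensional matching of $Q_d$ is a perfect matching $M$ of $Q_d$ such that $Q_d-M$ is isomorphic to two disjoint copies of $Q_{d-1}$. A list assignment $L$ for $Q_d$ assigns to every edge $e$ a (possibly empty) set $L(e)\subseteq\{1,\dots,d\}$; it is $\beta$-sparse if (i) $|L(e)|\le\beta d$ for each edge $e$; (ii) for every vertex $v$, each color in $\{1,\dots,d\}$ occurs in at most $\beta d$ lists of edges incident to $v$; (iii) for every $27$-neighborhood $W$ of an edge and every dimensional matching $M$, each color occurs in at most $\beta d$ lists of edges of $M$ contained in $W$. **Corollary.** There is a constant $\beta>0$ with the following property. For all integers $d\ge 0$ and $t>55$, if $L$ is a $\beta$-sparse list assignment for $Q_d$, $\varphi$ is a precoloring, with colors from $\{1,\dots,d\}$, of the edges of a distance-$t$ matching in $Q_d$, and $\varphi(e)\notin L(e)$ for every precolored edge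 $e$, then there is a proper edge coloring $f$ of $Q_d$ with colors $1,\dots,d$ that agrees with $\varphi$ on every precolored edge and avoids $L$, i.e. $f(e)\notin L(e)$ for every edge $e$ of $Q_d$. -/

import Mathlib

/-- The `d`-dimensional hypercube `Q_d`: the vertices are the binary strings of length `d`, and two
of them are adjacent when they differ in exactly one coordinate. -/
def hypercube (d : ℕ) : SimpleGraph (Fin d → Bool) where
  Adj x y := hammingDist x y = 1
  symm := ⟨fun x y h => (hammingDist_comm y x).trans h⟩
  loopless := ⟨fun x h => by simp at h⟩

/-- The distance between two edges: the number of edges in a shortest path between an endpoint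
of `e` and an endpoint of `e'` (infinite if there is no such path). -/
noncomputable def edgeDist {V : Type*} (G : SimpleGraph V) (e e' : Sym2 V) : ℕ∞ :=
  ⨅ u ∈ e, ⨅ v ∈ e', G.edist u v

/-- The edge set of the `t`-neighborhood of the edge `e`: all edges at distance at most `t`
from `e`. -/
def edgeNeighborhood {V : Type*} (G : SimpleGraph V) (t : ℕ) (e : G.edgeSet) : Set G.edgeSet :=
  {e' | edgeDist G e e' ≤ t}

/-- A distance-`t` matching: a matching in which any two distinct edges are at distance at
least `t` from each other. -/
def IsDistanceMatching {V : Type*} {G : SimpleGraph V} (t : ℕ) (M : G.Subgraph) : Prop :=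
  M.IsMatching ∧ ∀ e ∈ M.edgeSet, ∀ e' ∈ M.edgeSet, e ≠ e' → (t : ℕ∞) ≤ edgeDist G e e'

/-- A dimensional matching of `Q_d`: a perfect matching `M` such that `Q_d - M` is isomorphic to
two disjoint copies of `Q_{d-1}`. (There is none for `d = 0`, as `Q_0` has no perfect matching.) -/
def IsDimensionalMatching {d : ℕ} (M : (hypercube d).Subgraph) : Prop :=
  M.IsPerfectMatching ∧
    Nonempty ((hypercube d).deleteEdges M.edgeSet ≃g
      (hypercube (d - 1)).sum (hypercube (d - 1)))

/-- A list assignment for the edges of `Q_d`: each edge gets a (possibly empty) set of forbidden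
colors from the `d` colors. -/
abbrev ListAssignment (d : ℕ) : Type := (hypercube d).edgeSet → Finset (Fin d)

/-- `β`-sparse list assignments for `Q_d`. -/
structure IsSparse {d : ℕ} (β : ℝ) (L : ListAssignment d) : Prop where
  /-- every list has at most `β d` colors -/
  card_le : ∀ e, ((L e).card : ℝ) ≤ β * d
  /-- at every vertex, each color occurs in at most `β d` lists of incident edges -/
  vertex_le : ∀ (v : Fin d → Bool) (c : Fin d),
    (({e | v ∈ (e : Sym2 (Fin d → Bool)) ∧ c ∈ L e} : Set (hypercube d).edgeSet).ncard : ℝ) ≤ β * d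
  /-- in every `27`-neighborhood, each color occurs in at most `β d` lists of edges of any given
  dimensional matching -/
  neighborhood_le : ∀ (e₀ : (hypercube d).edgeSet) (M : (hypercube d).Subgraph),
    IsDimensionalMatching M → ∀ c : Fin d,
    (({e | e ∈ edgeNeighborhood (hypercube d) 27 e₀ ∧
        (e : Sym2 (Fin d → Bool)) ∈ M.edgeSet ∧ c ∈ L e} :
        Set (hypercube d).edgeSet).ncard : ℝ) ≤ β * d

/-- A (partial) edge precoloring of `Q_d` with `d` colors; `none` means that the edge is not
precolored. -/
abbrev EdgePrecoloring (d : ℕ) : Type := (hypercube d).edgeSet → Option (Fin d)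

/-- A proper `d`-edge coloring of `Q_d`: a proper vertex coloring of the line graph. -/
abbrev ProperEdgeColoring (d : ℕ) : Type := (hypercube d).lineGraph.Coloring (Fin d)

/-- The coloring `f` agrees with the precoloring `φ` on every precolored edge. -/
def ProperEdgeColoring.Extends {d : ℕ} (f : ProperEdgeColoring d) (φ : EdgePrecoloring d) : Prop :=
  ∀ e c, φ e = some c → f e = c

/-- The coloring `f` gives no edge a color from its list. -/
def ProperEdgeColoring.Avoids {d : ℕ} (f : ProperEdgeColoring d) (L : ListAssignment d) : Prop :=
  ∀ e, f e ∉ L e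

/-!
The argument starts from a standard coloring, in which all edges of direction `i` get the color
`σ i` for a permutation `σ`, and repairs it by interchanging the two colors of bicolored `4`-cycles
("faces"). Interchanging the colors of pairwise edge-disjoint bicolored faces keeps a coloring
proper (`IsProperColoring.exists_swapFaces`).

If `β d < 1`, all lists are empty. An edge `(u, i)` with prescribed color `j ≠ i` then gets it from
an interchange on its face in the directions `i, j`, and these faces are disjoint because the
precolored edges are far apart (`SeparatedPrecoloring.exists_extension`). Otherwise `d` is large,
and there are three steps.

* Counting permutations gives a `σ` for which few edges at any vertex, and few of the recolorings
  considered below, run into a forbidden color (`exists_perm_card_lt`, `SparseLists.exists_perm`).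
  Only exponentially many events have to be avoided, while each of them has probability at most
  `b ^ m / m!`, where `m` is a fixed fraction of `d` and `b` is far smaller.
* A precolored edge receives its color through a gadget inside a `3`-dimensional subcube. One of
  the three directions of the subcube is free, and it is chosen so that every recolored edge gets an
  allowed color (`SeparatedPrecoloring.exists_gadgets`).
* Each remaining edge whose standard color is forbidden is recolored by an interchange on a face
  through it. Most directions are suitable for this, and a face chosen at one edge meets only a
  small fraction of the faces available at the others (`SwapDirection.ncard_facesMeet_le`),
  because the lists are sparse in neighborhoods. So edge-disjoint faces can be chosen at all these
  edges simultaneously, by the existence of an independent transversal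
  (`exists_independent_transversal`), which is proved by counting partial transversals.
-/

/-! ### Independent transversals -/

/-- Partial independent transversals: functions `τ` choosing an option `τ e ∈ A e` for each
`e ∈ S`, with no two choices in conflict. Outside `S` the value is frozen to `o`, so that a partial
transversal on `S` is counted once. -/
noncomputable def partialTransversals {E ι : Type*} [Fintype E] [Fintype ι] (A : E → Finset ι)
    (conf : E → ι → E → ι → Prop) (o : ι) (S : Finset E) : Finset (E → ι) := by
  classical
  exact Finset.univ.filter fun τ => (∀ e ∈ S, τ e ∈ A e) ∧ (∀ e ∉ S, τ e = o) ∧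
    ∀ e ∈ S, ∀ e' ∈ S, e' ≠ e → ¬ conf e (τ e) e' (τ e')

section Transversal

variable {E ι : Type*} [Fintype E] [Fintype ι] {A : E → Finset ι}
  {conf : E → ι → E → ι → Prop} {o : ι}

theorem mem_partialTransversals {S : Finset E} {τ : E → ι} :
    τ ∈ partialTransversals A conf o S ↔ (∀ e ∈ S, τ e ∈ A e) ∧ (∀ e ∉ S, τ e = o) ∧
      ∀ e ∈ S, ∀ e' ∈ S, e' ≠ e → ¬ conf e (τ e) e' (τ e') := by
  classical
  simp [partialTransversals]

/-- Prescribing one value leaves at most as many partial transversals as there are on the smaller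
index set. -/
theorem card_partialTransversals_eq_le [DecidableEq E] [DecidableEq ι] {S : Finset E} {e : E}
    (j : ι) :
    ((partialTransversals A conf o S).filter fun τ => τ e = j).card ≤
      (partialTransversals A conf o (S.erase e)).card := by
  refine Finset.card_le_card_of_injOn (fun τ => Function.update τ e o) ?_ ?_
  · intro τ hτ
    simp only [Finset.coe_filter, Set.mem_ofPred_eq, mem_partialTransversals] at hτ
    obtain ⟨⟨h1, h2, h3⟩, -⟩ := hτ
    simp only [Finset.mem_coe, mem_partialTransversals]
    refine ⟨fun a ha => ?_, fun a ha => ?_, fun a ha a' ha' hne => ?_⟩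
    · rw [Finset.mem_erase] at ha
      rw [Function.update_of_ne ha.1]
      exact h1 a ha.2
    · by_cases hae : a = e
      · subst hae; simp
      · rw [Function.update_of_ne hae]
        exact h2 a fun h => ha (Finset.mem_erase.2 ⟨hae, h⟩)
    · rw [Finset.mem_erase] at ha ha'
      rw [Function.update_of_ne ha.1, Function.update_of_ne ha'.1]
      exact h3 a ha.2 a' ha'.2 hne
  · intro τ hτ τ' hτ' h
    simp only [Finset.coe_filter, Set.mem_ofPred_eq] at hτ hτ'
    funext a
    by_cases hae : a = e
    · rw [hae, hτ.2, hτ'.2]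
    · have := congrFun h a
      simpa [Function.update_of_ne hae] using this

/-- The counting step: adding one index multiplies the number of partial transversals by at least
`N / 2`. By induction each conflicting option is taken by at most a fraction `2 / N` of the partial
transversals, so at most half of all one-step extensions are spoiled. -/
theorem mul_card_partialTransversals_le [DecidableEq E] {C : Finset E} {N Δ : ℕ}
    (hsymm : ∀ e j e' j', conf e j e' j' → conf e' j' e j)
    (hN : ∀ e ∈ C, N ≤ (A e).card) (hpos : 0 < N) (hΔN : 4 * Δ ≤ N)
    (hΔ : ∀ e ∈ C, ∀ j ∈ A e, ∃ Q : Finset (E × ι), Q.card ≤ Δ ∧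
      ∀ e' ∈ C, e' ≠ e → ∀ j' ∈ A e', conf e j e' j' → (e', j') ∈ Q) :
    ∀ (n : ℕ) (S : Finset E) (e : E), S.card = n → S ⊆ C → e ∈ C → e ∉ S →
      N * (partialTransversals A conf o S).card ≤
        2 * (partialTransversals A conf o (insert e S)).card := by
  classical
  intro n
  induction n using Nat.strong_induction_on with
  | _ n ih =>
  intro S e hSn hSC heC heS
  set T := partialTransversals A conf o S with hT
  set T' := partialTransversals A conf o (insert e S) with hT'
  choose! Q hQcard hQ using hΔ
  set bad : Finset (ι × (E → ι)) := (A e ×ˢ T).filter fun p =>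
    ∃ e' ∈ S, conf e p.1 e' (p.2 e') with hbad
  set good : Finset (ι × (E → ι)) := (A e ×ˢ T).filter fun p =>
    ¬ ∃ e' ∈ S, conf e p.1 e' (p.2 e') with hgood
  have hsum : bad.card + good.card = (A e).card * T.card := by
    rw [hbad, hgood, Finset.card_filter_add_card_filter_not, Finset.card_product]
  have hgoodle : good.card ≤ T'.card := by
    refine Finset.card_le_card_of_injOn (fun p => Function.update p.2 e p.1) ?_ ?_
    · rintro ⟨j, τ⟩ hp
      simp only [hgood, Finset.coe_filter, Finset.mem_product, Set.mem_ofPred_eq, hT,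
        mem_partialTransversals, not_exists, not_and] at hp
      obtain ⟨⟨hj, h1, h2, h3⟩, h4⟩ := hp
      have hne : ∀ a ∈ S, a ≠ e := fun a ha h => heS (h ▸ ha)
      simp only [hT', Finset.mem_coe, mem_partialTransversals]
      refine ⟨fun a ha => ?_, fun a ha => ?_, fun a ha a' ha' haa' => ?_⟩
      · rcases Finset.mem_insert.1 ha with rfl | ha
        · simpa using hj
        · rw [Function.update_of_ne (hne a ha)]
          exact h1 a ha
      · rw [Finset.mem_insert, not_or] at ha
        rw [Function.update_of_ne ha.1]
        exact h2 a ha.2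
      · rcases Finset.mem_insert.1 ha with rfl | hb
        · rcases Finset.mem_insert.1 ha' with rfl | hb'
          · exact absurd rfl haa'
          · rw [Function.update_self, Function.update_of_ne (hne a' hb')]
            exact h4 a' hb'
        · rcases Finset.mem_insert.1 ha' with rfl | hb'
          · rw [Function.update_self, Function.update_of_ne (hne a hb)]
            exact fun h => h4 a hb (hsymm _ _ _ _ h)
          · rw [Function.update_of_ne (hne a' hb'), Function.update_of_ne (hne a hb)]
            exact h3 a hb a' hb' haa'
    · rintro ⟨j, τ⟩ hp ⟨j', τ'⟩ hp' h
      simp only [hgood, Finset.coe_filter, Finset.mem_product, Set.mem_ofPred_eq, hT,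
        mem_partialTransversals] at hp hp'
      simp only at h
      have hj : j = j' := by simpa using congrFun h e
      refine Prod.ext hj (funext fun a => ?_)
      by_cases hae : a = e
      · subst hae
        exact (hp.1.2.2.1 a heS).trans (hp'.1.2.2.1 a heS).symm
      · simpa [Function.update_of_ne hae] using congrFun h a
  have hbadle : N * bad.card ≤ (A e).card * (Δ * (2 * T.card)) := by
    have hsub : bad ⊆ (A e).biUnion fun j => ((Q e j).filter fun q => q.1 ∈ S).biUnion fun q =>
        (T.filter fun τ => τ q.1 = q.2).image fun τ => (j, τ) := by
      rintro ⟨j, τ⟩ hp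
      simp only [hbad, Finset.mem_filter, Finset.mem_product] at hp
      obtain ⟨⟨hj, hτ⟩, e', he', hc⟩ := hp
      have hτ' := mem_partialTransversals.1 (hT ▸ hτ)
      simp only [Finset.mem_biUnion, Finset.mem_filter, Finset.mem_image]
      exact ⟨j, hj, (e', τ e'), ⟨hQ e heC j hj e' (hSC he') (fun h => heS (h ▸ he')) _
        (hτ'.1 e' he') hc, he'⟩, τ, ⟨hτ, rfl⟩, rfl⟩
    have hcard : ∀ j ∈ A e, N * (((Q e j).filter fun q => q.1 ∈ S).biUnion fun q =>
        (T.filter fun τ => τ q.1 = q.2).image fun τ => (j, τ)).card ≤ Δ * (2 * T.card) := by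
      intro j hj
      calc _ ≤ N * ∑ q ∈ (Q e j).filter fun q => q.1 ∈ S,
              ((T.filter fun τ => τ q.1 = q.2).image fun τ => (j, τ)).card :=
            Nat.mul_le_mul_left _ Finset.card_biUnion_le
        _ = ∑ q ∈ (Q e j).filter fun q => q.1 ∈ S,
              N * ((T.filter fun τ => τ q.1 = q.2).image fun τ => (j, τ)).card :=
            Finset.mul_sum _ _ _
        _ ≤ ∑ q ∈ (Q e j).filter fun q => q.1 ∈ S, 2 * T.card := by
            refine Finset.sum_le_sum fun q hq => ?_
            have hqS := (Finset.mem_filter.1 hq).2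
            have h1 := Finset.card_image_le (s := T.filter fun τ => τ q.1 = q.2)
              (f := fun τ => (j, τ))
            have h2 := card_partialTransversals_eq_le (A := A) (conf := conf) (o := o)
              (S := S) (e := q.1) q.2
            have h3 := ih (S.erase q.1).card (hSn ▸ Finset.card_erase_lt_of_mem hqS)
              (S.erase q.1) q.1 rfl ((Finset.erase_subset _ _).trans hSC) (hSC hqS)
              (Finset.notMem_erase _ _)
            rw [Finset.insert_erase hqS] at h3
            exact (Nat.mul_le_mul_left _ (h1.trans h2)).trans h3
        _ = ((Q e j).filter fun q => q.1 ∈ S).card * (2 * T.card) := by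
            rw [Finset.sum_const, smul_eq_mul]
        _ ≤ Δ * (2 * T.card) :=
            Nat.mul_le_mul_right _ ((Finset.card_filter_le _ _).trans (hQcard e heC j hj))
    calc N * bad.card ≤ N * ∑ j ∈ A e, _ :=
          Nat.mul_le_mul_left _ ((Finset.card_le_card hsub).trans Finset.card_biUnion_le)
      _ = ∑ j ∈ A e, N * _ := Finset.mul_sum _ _ _
      _ ≤ ∑ j ∈ A e, Δ * (2 * T.card) := Finset.sum_le_sum hcard
      _ = _ := by rw [Finset.sum_const, smul_eq_mul]
  have hhalf : 2 * bad.card ≤ (A e).card * T.card := by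
    refine Nat.le_of_mul_le_mul_left ?_ hpos
    calc N * (2 * bad.card) = 2 * (N * bad.card) := by ring
      _ ≤ 2 * ((A e).card * (Δ * (2 * T.card))) := Nat.mul_le_mul_left _ hbadle
      _ = 4 * Δ * ((A e).card * T.card) := by ring
      _ ≤ N * ((A e).card * T.card) := Nat.mul_le_mul_right _ hΔN
  have := Nat.mul_le_mul_right T.card (hN e heC)
  omega

/-- **Independent transversals.** If every index has at least `N` options, and every option is in
conflict with at most `N / 4` options of other indices, then options can be chosen for all indices
without conflicts. -/
theorem exists_independent_transversal [DecidableEq E] [Nonempty ι] {C : Finset E} {N Δ : ℕ}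
    (hsymm : ∀ e j e' j', conf e j e' j' → conf e' j' e j)
    (hN : ∀ e ∈ C, N ≤ (A e).card) (hpos : 0 < N) (hΔN : 4 * Δ ≤ N)
    (hΔ : ∀ e ∈ C, ∀ j ∈ A e, ∃ Q : Finset (E × ι), Q.card ≤ Δ ∧
      ∀ e' ∈ C, e' ≠ e → ∀ j' ∈ A e', conf e j e' j' → (e', j') ∈ Q) :
    ∃ τ : E → ι, (∀ e ∈ C, τ e ∈ A e) ∧
      ∀ e ∈ C, ∀ e' ∈ C, e' ≠ e → ¬ conf e (τ e) e' (τ e') := by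
  classical
  obtain ⟨o⟩ := ‹Nonempty ι›
  have key : ∀ S : Finset E, S ⊆ C → 0 < (partialTransversals A conf o S).card := by
    intro S
    induction S using Finset.induction_on with
    | empty =>
      intro _
      exact Finset.card_pos.2 ⟨fun _ => o, mem_partialTransversals.2 (by simp)⟩
    | insert e S heS ih =>
      intro h
      have h1 := ih ((Finset.subset_insert _ _).trans h)
      have h2 := mul_card_partialTransversals_le (o := o) hsymm hN hpos hΔN hΔ S.card S e rfl
        ((Finset.subset_insert _ _).trans h) (h (Finset.mem_insert_self _ _)) heS
      have := Nat.mul_pos hpos h1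
      omega
  obtain ⟨τ, hτ⟩ := Finset.card_pos.1 (key C subset_rfl)
  obtain ⟨h1, -, h3⟩ := mem_partialTransversals.1 hτ
  exact ⟨τ, h1, h3⟩

end Transversal

/-! ### Permutations avoiding tables of small sets -/

section RandomPermutation

open scoped Nat

variable {n : ℕ}

theorem card_perm_eqOn_le (T : Finset (Fin n)) (σ₀ : Equiv.Perm (Fin n)) :
    (Finset.univ.filter fun σ : Equiv.Perm (Fin n) => ∀ j ∈ T, σ j = σ₀ j).card ≤
      (n - T.card)! := by
  classical
  have hcard : Fintype.card {f : Equiv.Perm (Fin n) // ∀ a, ¬ a ∉ T → f a = a} =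
      (n - T.card)! := by
    rw [← Fintype.card_congr (Equiv.Perm.subtypeEquivSubtypePerm fun a => a ∉ T),
      Fintype.card_perm]
    simp
  rw [← hcard, Fintype.card_subtype]
  refine Finset.card_le_card_of_injOn (fun σ => σ₀⁻¹ * σ) ?_ ?_
  · intro σ hσ
    simp only [Finset.coe_filter, Finset.mem_univ, true_and, Set.mem_ofPred_eq] at hσ ⊢
    intro a ha
    rw [not_not] at ha
    simp [hσ a ha]
  · intro σ _ τ _ h
    exact mul_left_cancel h

/-- The number of permutations `σ` with `σ j ∈ B j` for all `j ∈ T`: there are at most `b ^ #T`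
choices on `T`, and each extends in at most `(n - #T)!` ways. -/
theorem card_perm_mem_le (T : Finset (Fin n)) (B : Fin n → Finset (Fin n)) {b : ℕ}
    (hB : ∀ j, (B j).card ≤ b) :
    (Finset.univ.filter fun σ : Equiv.Perm (Fin n) => ∀ j ∈ T, σ j ∈ B j).card ≤
      (n - T.card)! * b ^ T.card := by
  classical
  set P := Finset.univ.filter fun σ : Equiv.Perm (Fin n) => ∀ j ∈ T, σ j ∈ B j
  let f : Equiv.Perm (Fin n) → (T → Fin n) := fun σ j => σ j
  have himg : (P.image f).card ≤ b ^ T.card := by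
    calc (P.image f).card ≤ (Fintype.piFinset fun j : T => B j).card := by
          refine Finset.card_le_card fun h hh => ?_
          obtain ⟨σ, hσ, rfl⟩ := Finset.mem_image.1 hh
          rw [Fintype.mem_piFinset]
          exact fun j => (Finset.mem_filter.1 hσ).2 j j.2
      _ = ∏ j : T, (B j).card := Fintype.card_piFinset _
      _ ≤ ∏ _j : T, b := Finset.prod_le_prod' fun j _ => hB j
      _ = b ^ T.card := by simp
  refine (Finset.card_le_mul_card_image (f := f) P (n - T.card)! ?_).trans
    (Nat.mul_le_mul_left _ himg)
  intro h hh
  obtain ⟨σ₀, -, rfl⟩ := Finset.mem_image.1 hh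
  refine (Finset.card_le_card ?_).trans (card_perm_eqOn_le T σ₀)
  intro σ hσ
  rw [Finset.mem_filter] at hσ ⊢
  exact ⟨Finset.mem_univ _, fun j hj => congrFun hσ.2 ⟨j, hj⟩⟩

/-- Given fewer than `m! / b ^ m` tables with rows of size at most `b`, some permutation hits each
table in fewer than `m` rows: a given set of `m` rows is hit by at most `(n - m)! * b ^ m`
permutations, and there are `n! / (m! * (n - m)!)` such sets. -/
theorem exists_perm_card_lt {κ : Type*} [Fintype κ] (B : κ → Fin n → Finset (Fin n)) {b m : ℕ}
    (hB : ∀ t j, (B t j).card ≤ b) (hm : Fintype.card κ * b ^ m < m !) :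
    ∃ σ : Equiv.Perm (Fin n), ∀ t, (Finset.univ.filter fun j => σ j ∈ B t j).card < m := by
  classical
  by_cases hmn : m ≤ n
  swap
  · refine ⟨1, fun t => lt_of_le_of_lt (Finset.card_filter_le _ _) ?_⟩
    simpa using hmn
  by_contra! hcon
  have hcover : (Finset.univ : Finset (Equiv.Perm (Fin n))) ⊆
      (Finset.univ : Finset κ).biUnion fun t =>
        (Finset.powersetCard m (Finset.univ : Finset (Fin n))).biUnion fun T =>
          Finset.univ.filter fun σ : Equiv.Perm (Fin n) => ∀ j ∈ T, σ j ∈ B t j := by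
    intro σ _
    obtain ⟨t, ht⟩ := hcon σ
    obtain ⟨T, hT, hTm⟩ := Finset.exists_subset_card_eq ht
    simp only [Finset.mem_biUnion, Finset.mem_univ, true_and, Finset.mem_powersetCard,
      Finset.mem_filter]
    exact ⟨t, T, ⟨Finset.subset_univ _, hTm⟩, fun j hj => (Finset.mem_filter.1 (hT hj)).2⟩
  have h1 : n ! ≤ Fintype.card κ * (n.choose m * ((n - m)! * b ^ m)) := by
    calc n ! = (Finset.univ : Finset (Equiv.Perm (Fin n))).card := by
          rw [Finset.card_univ, Fintype.card_perm, Fintype.card_fin]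
      _ ≤ _ := Finset.card_le_card hcover
      _ ≤ _ := Finset.card_biUnion_le_card_mul _ _ (n.choose m * ((n - m)! * b ^ m)) ?_
    intro t _
    refine (Finset.card_biUnion_le_card_mul _ _ ((n - m)! * b ^ m) ?_).trans_eq ?_
    · intro T hT
      have := card_perm_mem_le T (B t) (hB t)
      rwa [(Finset.mem_powersetCard.1 hT).2] at this
    · rw [Finset.card_powersetCard, Finset.card_univ, Fintype.card_fin]
  have h2 : n.choose m * (n - m)! * (Fintype.card κ * b ^ m) < n.choose m * (n - m)! * m ! :=
    Nat.mul_lt_mul_of_pos_left hm (Nat.mul_pos (Nat.choose_pos hmn) (Nat.factorial_pos _))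
  have h3 := Nat.choose_mul_factorial_mul_factorial hmn
  have h4 : Fintype.card κ * (n.choose m * ((n - m)! * b ^ m)) =
    n.choose m * (n - m)! * (Fintype.card κ * b ^ m) := by ring
  have h5 : n.choose m * (n - m)! * m ! = n ! := by rw [← h3]; ring
  omega

theorem pow_self_le_three_pow_mul_factorial (m : ℕ) : m ^ m ≤ 3 ^ m * m ! := by
  have h1 : (m : ℝ) ^ m / m ! ≤ Real.exp m := Real.pow_div_factorial_le_exp _ (by positivity) m
  have h2 : Real.exp m ≤ 3 ^ m := by
    rw [← Real.exp_one_pow]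
    exact pow_le_pow_left₀ (Real.exp_pos 1).le (Real.exp_one_lt_d9.le.trans (by norm_num)) m
  have h3 : (0 : ℝ) < m ! := by exact_mod_cast Nat.factorial_pos m
  have h4 := (div_le_iff₀ h3).1 (h1.trans h2)
  exact_mod_cast h4

end RandomPermutation

/-! ### Subcubes and interchanges of colors on faces -/

/-- The neighbour of the vertex `x` along direction `i`. An edge of the hypercube is encoded by a
pair `(x, i)`, standing for the edge between `x` and `flipAt x i`; the only other code of that edge
is `(flipAt x i, i)`. -/
def flipAt {d : ℕ} (x : Fin d → Bool) (i : Fin d) : Fin d → Bool := Function.update x i (!x i)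

section Cube

variable {d : ℕ}

@[simp] theorem flipAt_self (x : Fin d → Bool) (i : Fin d) : flipAt x i i = !x i := by
  simp [flipAt]

theorem flipAt_of_ne (x : Fin d → Bool) {i l : Fin d} (h : l ≠ i) : flipAt x i l = x l := by
  simp [flipAt, Function.update_of_ne h]

@[simp] theorem flipAt_flipAt (x : Fin d → Bool) (i : Fin d) : flipAt (flipAt x i) i = x := by
  simp [flipAt]

theorem flipAt_comm (x : Fin d → Bool) (i j : Fin d) :
    flipAt (flipAt x i) j = flipAt (flipAt x j) i := by
  funext l
  by_cases hi : l = i <;> by_cases hj : l = j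
  · subst hi; subst hj; rfl
  · subst hi; simp [flipAt_of_ne, hj]
  · subst hj; simp [flipAt_of_ne, hi]
  · simp [flipAt_of_ne, hi, hj]

theorem flipAt_injective (x : Fin d → Bool) : Function.Injective (flipAt x) := by
  intro i j h
  by_contra hij
  have := congrFun h i
  simp [flipAt_of_ne x hij] at this

theorem hammingDist_flipAt (x : Fin d → Bool) (i : Fin d) : hammingDist x (flipAt x i) = 1 := by
  rw [hammingDist, Finset.card_eq_one]
  refine ⟨i, Finset.ext fun l => ?_⟩
  rw [Finset.mem_filter, Finset.mem_singleton]
  refine ⟨fun h => ?_, fun h => by simp [h]⟩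
  by_contra hl
  exact h.2 (flipAt_of_ne x hl).symm

/-- The subcube through `x` spanned by the directions in `D`. -/
def subcube (D : Finset (Fin d)) (x : Fin d → Bool) : Finset (Fin d → Bool) :=
  Finset.univ.filter fun y => ∀ l ∉ D, y l = x l

theorem mem_subcube {D : Finset (Fin d)} {x y : Fin d → Bool} :
    y ∈ subcube D x ↔ ∀ l ∉ D, y l = x l := by
  simp [subcube]

theorem self_mem_subcube (D : Finset (Fin d)) (x : Fin d → Bool) : x ∈ subcube D x :=
  mem_subcube.2 fun _ _ => rfl

theorem mem_subcube_comm {D : Finset (Fin d)} {x y : Fin d → Bool} :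
    y ∈ subcube D x ↔ x ∈ subcube D y := by
  simp only [mem_subcube, eq_comm]

theorem flipAt_mem_subcube {D : Finset (Fin d)} {x y : Fin d → Bool} {i : Fin d} (hi : i ∈ D) :
    flipAt y i ∈ subcube D x ↔ y ∈ subcube D x := by
  simp only [mem_subcube]
  refine forall₂_congr fun l hl => ?_
  rw [flipAt_of_ne y (by rintro rfl; exact hl hi)]

theorem subcube_mono {D D' : Finset (Fin d)} (h : D ⊆ D') (x : Fin d → Bool) :
    subcube D x ⊆ subcube D' x := fun _ hy =>
  mem_subcube.2 fun l hl => mem_subcube.1 hy l fun h' => hl (h h')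

theorem subcube_flipAt {D : Finset (Fin d)} {i : Fin d} (hi : i ∈ D) (x : Fin d → Bool) :
    subcube D (flipAt x i) = subcube D x := by
  ext y
  rw [mem_subcube_comm, flipAt_mem_subcube hi, mem_subcube_comm]

theorem hammingDist_le_of_mem_subcube {D : Finset (Fin d)} {x y : Fin d → Bool}
    (h : y ∈ subcube D x) : hammingDist x y ≤ D.card := by
  refine Finset.card_le_card fun l hl => ?_
  by_contra hlD
  exact (Finset.mem_filter.1 hl).2 (mem_subcube.1 h l hlD).symm

theorem card_subcube_le (D : Finset (Fin d)) (x : Fin d → Bool) :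
    (subcube D x).card ≤ 2 ^ D.card := by
  classical
  have : (Finset.univ : Finset (D → Bool)).card = 2 ^ D.card := by simp
  rw [← this]
  refine Finset.card_le_card_of_injOn (fun y l => y l) (fun _ _ => Finset.mem_coe.2
    (Finset.mem_univ _)) ?_
  intro y hy z hz h
  funext l
  by_cases hl : l ∈ D
  · exact congrFun h ⟨l, hl⟩
  · rw [mem_subcube.1 hy l hl, mem_subcube.1 hz l hl]

theorem mem_face_iff {x y : Fin d → Bool} {i j : Fin d} :
    y ∈ subcube {i, j} x ↔ (y = x ∨ y = flipAt x i) ∨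
      (y = flipAt x j ∨ y = flipAt (flipAt x i) j) := by
  constructor
  · intro h
    rw [mem_subcube] at h
    have key : ∀ z : Fin d → Bool, (∀ l, l ≠ i → l ≠ j → y l = z l) → y i = z i → y j = z j →
        y = z := by
      intro z hz hi hj
      funext l
      by_cases hli : l = i
      · rw [hli, hi]
      · by_cases hlj : l = j
        · rw [hlj, hj]
        · exact hz l hli hlj
    have h' : ∀ l, l ≠ i → l ≠ j → y l = x l := fun l hi hj => h l (by simp [hi, hj])
    by_cases hij : i = j
    · subst hij
      by_cases hi : y i = x i
      · exact Or.inl (Or.inl (key _ h' hi hi))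
      · have : y i = flipAt x i i := by simpa [Bool.eq_not] using hi
        exact Or.inl (Or.inr (key _ (fun l hl hl' => by rw [flipAt_of_ne x hl, h' l hl hl'])
          this this))
    · by_cases hi : y i = x i <;> by_cases hj : y j = x j
      · exact Or.inl (Or.inl (key _ h' hi hj))
      · refine Or.inr (Or.inl (key _ (fun l hl hl' => by rw [flipAt_of_ne x hl', h' l hl hl'])
          ?_ ?_))
        · rw [flipAt_of_ne x hij, hi]
        · simpa [Bool.eq_not] using hj
      · refine Or.inl (Or.inr (key _ (fun l hl hl' => by rw [flipAt_of_ne x hl, h' l hl hl'])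
          ?_ ?_))
        · simpa [Bool.eq_not] using hi
        · rw [flipAt_of_ne x (Ne.symm hij), hj]
      · refine Or.inr (Or.inr (key _ (fun l hl hl' => by
          rw [flipAt_of_ne _ hl', flipAt_of_ne x hl, h' l hl hl']) ?_ ?_))
        · rw [flipAt_of_ne _ hij]; simpa [Bool.eq_not] using hi
        · rw [flipAt_self, flipAt_of_ne x (Ne.symm hij)]; simpa [Bool.eq_not] using hj
  · have hi : i ∈ ({i, j} : Finset (Fin d)) := by simp
    have hj : j ∈ ({i, j} : Finset (Fin d)) := by simp
    rintro ((rfl | rfl) | (rfl | rfl)) <;>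
      simp [flipAt_mem_subcube hi, flipAt_mem_subcube hj, self_mem_subcube]

/-- A proper edge coloring of the hypercube with `d` colors, in the encoding of edges as pairs of a
vertex and a direction. -/
structure IsProperColoring (g : (Fin d → Bool) → Fin d → Fin d) : Prop where
  injective : ∀ x, Function.Injective (g x)
  flip : ∀ x i, g (flipAt x i) i = g x i

/-- The standard coloring, in which all edges of direction `i` get the color `σ i`. -/
theorem isProperColoring_perm (σ : Equiv.Perm (Fin d)) : IsProperColoring fun _ i => σ i :=
  ⟨fun _ => σ.injective, fun _ _ => rfl⟩

/-- Interchanging the two colors of a bicolored `4`-cycle preserves properness. -/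
theorem IsProperColoring.swapFace {g : (Fin d → Bool) → Fin d → Fin d} (hg : IsProperColoring g)
    {x : Fin d → Bool} {i j : Fin d}
    (hbi : ∀ y ∈ subcube {i, j} x, g y i = g x i ∧ g y j = g x j) :
    IsProperColoring fun y => if y ∈ subcube {i, j} x then g y ∘ Equiv.swap i j else g y := by
  have hi : i ∈ ({i, j} : Finset (Fin d)) := by simp
  have hj : j ∈ ({i, j} : Finset (Fin d)) := by simp
  refine ⟨fun y => ?_, fun y l => ?_⟩
  · split_ifs
    · exact (hg.injective y).comp (Equiv.swap i j).injective
    · exact hg.injective y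
  · by_cases hl : l ∈ ({i, j} : Finset (Fin d))
    · simp only [flipAt_mem_subcube hl]
      split_ifs with hy
      · have hy' := (flipAt_mem_subcube hl).2 hy
        rcases Finset.mem_insert.1 hl with rfl | hl'
        · simp only [Function.comp_apply, Equiv.swap_apply_left]
          rw [(hbi _ hy).2, (hbi _ hy').2]
        · obtain rfl := Finset.mem_singleton.1 hl'
          simp only [Function.comp_apply, Equiv.swap_apply_right]
          rw [(hbi _ hy).1, (hbi _ hy').1]
      · exact hg.flip y l
    · have hli : l ≠ i := fun h => hl (h ▸ hi)
      have hlj : l ≠ j := fun h => hl (h ▸ hj)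
      have : ∀ z, (if z ∈ subcube {i, j} x then g z ∘ Equiv.swap i j else g z) l = g z l := by
        intro z
        split_ifs
        · rw [Function.comp_apply, Equiv.swap_apply_of_ne_of_ne hli hlj]
        · rfl
      rw [this, this]
      exact hg.flip y l

/-- Interchanging the colors of any family of pairwise edge-disjoint bicolored `4`-cycles. -/
theorem IsProperColoring.exists_swapFaces {ι : Type*} (S : Finset ι) (X : ι → Fin d → Bool)
    (I J : ι → Fin d) {g : (Fin d → Bool) → Fin d → Fin d} (hg : IsProperColoring g)
    (hbi : ∀ s ∈ S, ∀ y ∈ subcube {I s, J s} (X s), g y (I s) = g (X s) (I s) ∧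
      g y (J s) = g (X s) (J s))
    (hdisj : ∀ s ∈ S, ∀ s' ∈ S, s ≠ s' → ∀ y ∈ subcube {I s, J s} (X s),
      y ∈ subcube {I s', J s'} (X s') → ∀ l ∈ ({I s, J s} : Finset (Fin d)),
        l ∉ ({I s', J s'} : Finset (Fin d))) :
    ∃ g' : (Fin d → Bool) → Fin d → Fin d, IsProperColoring g' ∧
      (∀ s ∈ S, ∀ y ∈ subcube {I s, J s} (X s), g' y (I s) = g (X s) (J s) ∧
        g' y (J s) = g (X s) (I s)) ∧
      ∀ y l, (∀ s ∈ S, y ∈ subcube {I s, J s} (X s) → l ∉ ({I s, J s} : Finset (Fin d))) →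
        g' y l = g y l := by
  classical
  induction S using Finset.induction_on with
  | empty => exact ⟨g, hg, by simp, by simp⟩
  | insert s S hs ih =>
    obtain ⟨g₁, hp, h1, h2⟩ := ih
      (fun t ht => hbi t (Finset.mem_insert_of_mem ht))
      (fun t ht t' ht' => hdisj t (Finset.mem_insert_of_mem ht) t' (Finset.mem_insert_of_mem ht'))
    have hne : ∀ t ∈ S, s ≠ t := fun t ht h => hs (h ▸ ht)
    have hold : ∀ y ∈ subcube {I s, J s} (X s), ∀ l ∈ ({I s, J s} : Finset (Fin d)),
        g₁ y l = g y l := fun y hy l hl => h2 y l fun t ht hyt =>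
      hdisj s (Finset.mem_insert_self _ _) t (Finset.mem_insert_of_mem ht) (hne t ht) y hy hyt l hl
    have hI : I s ∈ ({I s, J s} : Finset (Fin d)) := by simp
    have hJ : J s ∈ ({I s, J s} : Finset (Fin d)) := by simp
    have hX := self_mem_subcube {I s, J s} (X s)
    have hb := hbi s (Finset.mem_insert_self _ _)
    refine ⟨_, hp.swapFace (x := X s) (i := I s) (j := J s) ?_, ?_, ?_⟩
    · intro y hy
      rw [hold y hy _ hI, hold y hy _ hJ, hold _ hX _ hI, hold _ hX _ hJ]
      exact hb y hy
    · intro t ht y hy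
      rcases Finset.mem_insert.1 ht with rfl | ht
      · simp only [hy, if_true, Function.comp_apply, Equiv.swap_apply_left,
          Equiv.swap_apply_right, hold y hy _ hI, hold y hy _ hJ]
        exact ⟨(hb y hy).2, (hb y hy).1⟩
      · have key : ∀ l ∈ ({I t, J t} : Finset (Fin d)),
            (if y ∈ subcube {I s, J s} (X s) then g₁ y ∘ Equiv.swap (I s) (J s) else g₁ y) l =
              g₁ y l := by
          intro l hl
          split_ifs with hys
          · have := hdisj t (Finset.mem_insert_of_mem ht) s (Finset.mem_insert_self _ _)
              (hne t ht).symm y hy hys l hl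
            simp only [Finset.mem_insert, Finset.mem_singleton, not_or] at this
            rw [Function.comp_apply, Equiv.swap_apply_of_ne_of_ne this.1 this.2]
          · rfl
        rw [key _ (by simp), key _ (by simp)]
        exact h1 t ht y hy
    · intro y l hyl
      have h3 := h2 y l fun t ht => hyl t (Finset.mem_insert_of_mem ht)
      split_ifs with hys
      · have := hyl s (Finset.mem_insert_self _ _) hys
        simp only [Finset.mem_insert, Finset.mem_singleton, not_or] at this
        rw [Function.comp_apply, Equiv.swap_apply_of_ne_of_ne this.1 this.2, h3]
      · exact h3

end Cube

/-! ### Gadgets at the precolored edges -/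

section Counting

variable {α : Type*}

theorem ncard_or_le (p q : α → Prop) :
    {a | p a ∨ q a}.ncard ≤ {a | p a}.ncard + {a | q a}.ncard :=
  Set.ncard_union_le {a | p a} {a | q a}

theorem ncard_exists_mem_le {β : Type*} (s : Finset β) (p : β → α → Prop) {n : ℕ}
    (h : ∀ y ∈ s, {a | p y a}.ncard ≤ n) : {a | ∃ y ∈ s, p y a}.ncard ≤ s.card * n := by
  classical
  induction s using Finset.induction_on with
  | empty => simp
  | insert y s hy ih =>
    have h1 := ih fun z hz => h z (Finset.mem_insert_of_mem hz)
    have h2 := h y (Finset.mem_insert_self _ _)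
    have h3 := ncard_or_le (p y) fun a => ∃ z ∈ s, p z a
    have h4 : {a | ∃ z ∈ insert y s, p z a} = {a | p y a ∨ ∃ z ∈ s, p z a} := by
      ext a
      simp
    rw [h4, Finset.card_insert_of_notMem hy, add_mul, one_mul]
    omega

theorem ncard_le_of_injective {β : Type*} [Finite β] {p : α → Prop} {q : β → Prop} (f : α → β)
    (hf : Function.Injective f) (h : ∀ a, p a → q (f a)) : {a | p a}.ncard ≤ {b | q b}.ncard :=
  Set.ncard_le_ncard_of_injOn f h hf.injOn

theorem ncard_le_one_of_unique [Finite α] {p : α → Prop} (h : ∀ a b, p a → p b → a = b) :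
    {a | p a}.ncard ≤ 1 :=
  (Set.ncard_le_one_iff).2 fun ha hb => h _ _ ha hb

theorem ncard_mem_finset (s : Finset α) : {a | a ∈ s}.ncard = s.card :=
  Set.ncard_coe_finset s

theorem exists_not_of_ncard_lt {d : ℕ} {p : Fin d → Prop} (h : {k | p k}.ncard < d) :
    ∃ k, ¬ p k := by
  by_contra! hall
  have : {k | p k} = Set.univ := Set.eq_univ_of_forall hall
  rw [this, Set.ncard_univ, Nat.card_eq_fintype_card, Fintype.card_fin] at h
  exact lt_irrefl _ h

end Counting

section Gadgets

variable {d : ℕ}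

theorem mem_subcube_insert {D : Finset (Fin d)} {x y : Fin d → Bool}
    {k : Fin d} (h : y ∈ subcube (insert k D) x) : y ∈ subcube D x ∨ flipAt y k ∈ subcube D x := by
  rw [mem_subcube] at h
  by_cases hk : y k = x k
  · refine Or.inl (mem_subcube.2 fun l hl => ?_)
    by_cases hlk : l = k
    · rw [hlk, hk]
    · exact h l (by simp [hlk, hl])
  · refine Or.inr (mem_subcube.2 fun l hl => ?_)
    by_cases hlk : l = k
    · subst hlk
      rw [flipAt_self]
      revert hk
      cases y l <;> cases x l <;> simp
    · rw [flipAt_of_ne y hlk]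
      exact h l (by simp [hlk, hl])

/-- Lists `l x i` of forbidden colors on the edges `(x, i)` of the hypercube that are sparse: with
at most `b` colors each, with each color occurring at most `b` times at a vertex, and at most `b`
times (so at most `2 * b` times when edges are counted through their endpoints) among the parallel
edges in a small ball. -/
structure SparseLists (b : ℕ) (l : (Fin d → Bool) → Fin d → Finset (Fin d)) : Prop where
  flip : ∀ x i, l (flipAt x i) i = l x i
  card_le : ∀ x i, (l x i).card ≤ b
  vertex_le : ∀ x c, {i | c ∈ l x i}.ncard ≤ b
  near_le : ∀ x i c, {y | hammingDist x y ≤ 6 ∧ c ∈ l y i}.ncard ≤ 2 * b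

/-- A precoloring `p` of the edges in `P`, where any two distinct edges of `P` are far apart. -/
structure SeparatedPrecoloring (P : (Fin d → Bool) → Fin d → Prop)
    (p : (Fin d → Bool) → Fin d → Fin d) : Prop where
  flip_mem : ∀ x i, P x i → P (flipAt x i) i
  flip : ∀ x i, p (flipAt x i) i = p x i
  sep : ∀ x i y j, P x i → P y j → hammingDist x y ≤ 12 → i = j ∧ (y = x ∨ y = flipAt x i)

variable {P : (Fin d → Bool) → Fin d → Prop} {p : (Fin d → Bool) → Fin d → Fin d}

theorem SeparatedPrecoloring.eq_of_near (h : SeparatedPrecoloring P p) {x y : Fin d → Bool}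
    {i j : Fin d} (hx : P x i) (hy : P y j) (hxi : x i = false) (hyj : y j = false)
    (hd : hammingDist x y ≤ 12) : x = y ∧ i = j := by
  obtain ⟨rfl, rfl | rfl⟩ := h.sep x i y j hx hy hd
  · exact ⟨rfl, rfl⟩
  · rw [flipAt_self, hxi] at hyj
    simp at hyj

/-- Every edge has a code `(u, i)` with `u i = false`. -/
theorem exists_canonical (x : Fin d → Bool) (i : Fin d) :
    ∃ u, u i = false ∧ (x = u ∨ x = flipAt u i) := by
  cases h : x i
  · exact ⟨x, h, Or.inl rfl⟩
  · exact ⟨flipAt x i, by simp [h], Or.inr (by simp)⟩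

theorem SeparatedPrecoloring.exists_canonical_mem (h : SeparatedPrecoloring P p)
    {x : Fin d → Bool} {i : Fin d} (hx : P x i) :
    ∃ u, u i = false ∧ P u i ∧ (x = u ∨ x = flipAt u i) := by
  obtain ⟨u, hu, rfl | rfl⟩ := exists_canonical x i
  · exact ⟨x, hu, hx, Or.inl rfl⟩
  · have := h.flip_mem _ _ hx
    rw [flipAt_flipAt] at this
    exact ⟨u, hu, this, Or.inr rfl⟩

/-- Without forbidden colors, a separated precoloring extends: at each edge `(u, i)` whose
prescribed color `j` is not its standard color `i`, interchange the colors on the face through the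
edge in the directions `i` and `j`. -/
theorem SeparatedPrecoloring.exists_extension (h : SeparatedPrecoloring P p) :
    ∃ g : (Fin d → Bool) → Fin d → Fin d, IsProperColoring g ∧ ∀ x i, P x i → g x i = p x i := by
  classical
  let S : Finset ((Fin d → Bool) × Fin d) :=
    Finset.univ.filter fun s => s.1 s.2 = false ∧ P s.1 s.2
  have hS : ∀ s ∈ S, s.1 s.2 = false ∧ P s.1 s.2 := fun s hs => (Finset.mem_filter.1 hs).2
  have hface : ∀ (i j : Fin d) (x y : Fin d → Bool), y ∈ subcube {i, j} x → hammingDist x y ≤ 2 :=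
    fun i j x y hy => (hammingDist_le_of_mem_subcube hy).trans Finset.card_le_two
  have huniq : ∀ s ∈ S, ∀ s' ∈ S, ∀ j j' y, y ∈ subcube {s.2, j} s.1 →
      y ∈ subcube {s'.2, j'} s'.1 → s = s' := by
    intro s hs s' hs' j j' y hy hy'
    have h1 := hface _ _ _ _ hy
    have h2 := hface _ _ _ _ hy'
    rw [hammingDist_comm] at h2
    have h3 := hammingDist_triangle s.1 y s'.1
    obtain ⟨h4, h5⟩ := h.eq_of_near (hS s hs).2 (hS s' hs').2 (hS s hs).1 (hS s' hs').1 (by omega)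
    exact Prod.ext h4 h5
  obtain ⟨g, hg, hg1, hg2⟩ := (isProperColoring_perm (1 : Equiv.Perm (Fin d))).exists_swapFaces S
    Prod.fst Prod.snd (fun s => p s.1 s.2) (by simp)
    fun s hs s' hs' hne y hy hy' => absurd (huniq s hs s' hs' _ _ y hy hy') hne
  refine ⟨g, hg, fun x i hx => ?_⟩
  obtain ⟨u, hu, huP, hxu⟩ := h.exists_canonical_mem hx
  have hval := (hg1 (u, i) (Finset.mem_filter.2 ⟨Finset.mem_univ _, hu, huP⟩) u
    (self_mem_subcube _ _)).1
  rcases hxu with rfl | rfl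
  · exact hval
  · rw [hg.flip, h.flip]
    exact hval

/-- The constraints on the auxiliary direction `k` of the gadget at the precolored edge `(u, i)`
that is to get the color `σ j`: none of the edges recolored by the gadget, other than `(u, i)`,
gets a forbidden color. -/
structure GadgetDirection (l : (Fin d → Bool) → Fin d → Finset (Fin d)) (σ : Equiv.Perm (Fin d))
    (u : Fin d → Bool) (i j k : Fin d) : Prop where
  ne_left : k ≠ i
  ne_right : k ≠ j
  spoke : ∀ y ∈ subcube {i, j} u, σ j ∉ l y k ∧ σ i ∉ l y k
  side : ∀ y ∈ ({u, flipAt u i} : Finset (Fin d → Bool)), σ k ∉ l y j ∧ σ k ∉ l (flipAt y k) j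
  opposite : σ j ∉ l (flipAt u k) i

theorem ncard_apply_mem_le (σ : Equiv.Perm (Fin d)) (s : Finset (Fin d)) :
    {k | σ k ∈ s}.ncard ≤ s.card := by
  rw [← ncard_mem_finset s]
  exact ncard_le_of_injective σ σ.injective fun _ h => h

theorem SparseLists.ncard_flipAt_le {b : ℕ} {l : (Fin d → Bool) → Fin d → Finset (Fin d)}
    (hl : SparseLists b l) (u : Fin d → Bool) (i c : Fin d) :
    {k | c ∈ l (flipAt u k) i}.ncard ≤ 2 * b :=
  (ncard_le_of_injective (flipAt u) (flipAt_injective u) fun k hk =>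
    ⟨(hammingDist_flipAt u k).le.trans (by norm_num), hk⟩).trans (hl.near_le u i c)

theorem SparseLists.exists_gadgetDirection {b m : ℕ}
    {l : (Fin d → Bool) → Fin d → Finset (Fin d)} (hl : SparseLists b l) {σ : Equiv.Perm (Fin d)}
    (hσ : ∀ x i, {j | σ j ∈ l (flipAt x j) i}.ncard ≤ m) (hd : 12 * b + 2 * m + 2 < d)
    (u : Fin d → Bool) (i j : Fin d) : ∃ k, GadgetDirection l σ u i j k := by
  have h1 : {k | k = i}.ncard ≤ 1 := ncard_le_one_of_unique fun a b ha hb => ha.trans hb.symm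
  have h2 : {k | k = j}.ncard ≤ 1 := ncard_le_one_of_unique fun a b ha hb => ha.trans hb.symm
  have h3 : {k | ∃ y ∈ subcube {i, j} u, σ j ∈ l y k ∨ σ i ∈ l y k}.ncard ≤ 4 * (2 * b) := by
    refine (ncard_exists_mem_le (n := 2 * b) _ _ fun y _ => ?_).trans
      (Nat.mul_le_mul_right _ ((card_subcube_le _ _).trans
        (Nat.pow_le_pow_right (by norm_num) Finset.card_le_two)))
    have := ncard_or_le (fun k => σ j ∈ l y k) fun k => σ i ∈ l y k
    have := hl.vertex_le y (σ j)
    have := hl.vertex_le y (σ i)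
    omega
  have h4 : {k | ∃ y ∈ ({u, flipAt u i} : Finset (Fin d → Bool)),
      σ k ∈ l y j ∨ σ k ∈ l (flipAt y k) j}.ncard ≤ 2 * (b + m) := by
    refine (ncard_exists_mem_le (n := b + m) _ _ fun y _ => ?_).trans
      (Nat.mul_le_mul_right _ Finset.card_le_two)
    have := ncard_or_le (fun k => σ k ∈ l y j) fun k => σ k ∈ l (flipAt y k) j
    have := ncard_apply_mem_le σ (l y j)
    have := hl.card_le y j
    have := hσ y j
    omega
  have h5 := hl.ncard_flipAt_le u i (σ j)
  have h6 := ncard_or_le (fun k => k = i) fun k => k = j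
  have h7 := ncard_or_le (fun k => k = i ∨ k = j)
    fun k => ∃ y ∈ subcube {i, j} u, σ j ∈ l y k ∨ σ i ∈ l y k
  have h8 := ncard_or_le (fun k => (k = i ∨ k = j) ∨
      ∃ y ∈ subcube {i, j} u, σ j ∈ l y k ∨ σ i ∈ l y k)
    fun k => ∃ y ∈ ({u, flipAt u i} : Finset (Fin d → Bool)), σ k ∈ l y j ∨ σ k ∈ l (flipAt y k) j
  have h9 := ncard_or_le (fun k => ((k = i ∨ k = j) ∨
      ∃ y ∈ subcube {i, j} u, σ j ∈ l y k ∨ σ i ∈ l y k) ∨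
      ∃ y ∈ ({u, flipAt u i} : Finset (Fin d → Bool)), σ k ∈ l y j ∨ σ k ∈ l (flipAt y k) j)
    fun k => σ j ∈ l (flipAt u k) i
  obtain ⟨k, hk⟩ := exists_not_of_ncard_lt (h9.trans_lt (by omega))
  simp only [not_or, not_exists, not_and] at hk
  obtain ⟨⟨⟨⟨hi, hj⟩, hA⟩, hB⟩, hC⟩ := hk
  exact ⟨k, hi, hj, hA, hB, hC⟩

/-- The coloring with the precolored edges in place, before the conflicts with the lists are
removed. At a precolored edge `(u, i)` with standard color `σ i` and prescribed color `σ j`, an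
auxiliary direction `k` is chosen; interchanging the colors first on the two faces in the directions
`j, k` through the endpoints of the edge, and then on the face through the edge in the directions
`i, k`, gives the edge the color `σ j`. All edges recolored in this way receive allowed colors,
and the recoloring is confined to the subcubes spanned by `i, j, k`. -/
theorem SeparatedPrecoloring.exists_gadgets (h : SeparatedPrecoloring P p) {b m : ℕ}
    {l : (Fin d → Bool) → Fin d → Finset (Fin d)} (hl : SparseLists b l)
    (hpl : ∀ x i, P x i → p x i ∉ l x i) {σ : Equiv.Perm (Fin d)}
    (hσ : ∀ x i, {j | σ j ∈ l (flipAt x j) i}.ncard ≤ m) (hd : 12 * b + 2 * m + 2 < d) :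
    ∃ g : (Fin d → Bool) → Fin d → Fin d, IsProperColoring g ∧
      (∀ x i, P x i → g x i = p x i) ∧
      (∀ x i, g x i ≠ σ i → g x i ∉ l x i) ∧
      ∀ x, ∃ Q : Finset ((Fin d → Bool) × Fin d), Q.card ≤ 24 ∧
        ∀ y i, hammingDist x y ≤ 2 → (P y i ∨ g y i ≠ σ i) → (y, i) ∈ Q := by
  classical
  let J : (Fin d → Bool) × Fin d → Fin d := fun s => σ.symm (p s.1 s.2)
  have hσJ : ∀ s, σ (J s) = p s.1 s.2 := fun s => σ.apply_symm_apply _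
  have hex : ∀ s : (Fin d → Bool) × Fin d, ∃ k, GadgetDirection l σ s.1 s.2 (J s) k := fun s =>
    hl.exists_gadgetDirection hσ hd s.1 s.2 (J s)
  choose K hK using hex
  let D : (Fin d → Bool) × Fin d → Finset (Fin d) := fun s => {s.2, J s, K s}
  have hDcard : ∀ s, (D s).card ≤ 3 := fun s => Finset.card_le_three
  let S : Finset ((Fin d → Bool) × Fin d) :=
    Finset.univ.filter fun s => s.1 s.2 = false ∧ P s.1 s.2
  have hS : ∀ s, s ∈ S ↔ s.1 s.2 = false ∧ P s.1 s.2 := fun s => by simp [S]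
  have huniq : ∀ s ∈ S, ∀ s' ∈ S, hammingDist s.1 s'.1 ≤ 12 → s = s' := by
    intro s hs s' hs' hd
    rw [hS] at hs hs'
    obtain ⟨h4, h5⟩ := h.eq_of_near hs.2 hs'.2 hs.1 hs'.1 hd
    exact Prod.ext h4 h5
  have huniq' : ∀ s ∈ S, ∀ s' ∈ S, ∀ y, y ∈ subcube (D s) s.1 → y ∈ subcube (D s') s'.1 →
      s = s' := by
    intro s hs s' hs' y hy hy'
    have h1 := (hammingDist_le_of_mem_subcube hy).trans (hDcard s)
    have h2 := (hammingDist_le_of_mem_subcube hy').trans (hDcard s')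
    rw [hammingDist_comm] at h2
    have h3 := hammingDist_triangle s.1 y s'.1
    exact huniq s hs s' hs' (by omega)
  have hiD : ∀ s, s.2 ∈ D s := fun s => by simp [D]
  let S₁ : Finset ((Fin d → Bool) × Fin d) := S.filter fun s => J s ≠ s.2
  have hS₁ : ∀ s ∈ S₁, s ∈ S ∧ J s ≠ s.2 := fun s hs => Finset.mem_filter.1 hs
  -- first round: the faces in the directions `J s, K s` through both endpoints of the edge
  let X : ((Fin d → Bool) × Fin d) × Bool → Fin d → Bool := fun t =>
    if t.2 then flipAt t.1.1 t.1.2 else t.1.1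
  have hXsub : ∀ t y, y ∈ subcube {J t.1, K t.1} (X t) → y ∈ subcube (D t.1) t.1.1 := by
    intro t y hy
    have h1 : y ∈ subcube (D t.1) (X t) :=
      subcube_mono (by intro a ha; simp only [D, Finset.mem_insert, Finset.mem_singleton] at ha ⊢
                       tauto) _ hy
    simp only [X] at h1
    split_ifs at h1
    · rwa [subcube_flipAt (hiD _)] at h1
    · exact h1
  obtain ⟨g₁, hg₁, hg₁face, hg₁off⟩ := (isProperColoring_perm σ).exists_swapFaces
    (S₁ ×ˢ (Finset.univ : Finset Bool)) X (fun t => J t.1) (fun t => K t.1) (by simp) (by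
      rintro ⟨s, c⟩ hs ⟨s', c'⟩ hs' hne y hy hy'
      rw [Finset.mem_product] at hs hs'
      have hss' : s = s' := huniq' s (hS₁ s hs.1).1 s' (hS₁ s' hs'.1).1 y (hXsub (s, c) y hy)
        (hXsub (s', c') y hy')
      subst hss'
      exfalso
      have hi : s.2 ∉ ({J s, K s} : Finset (Fin d)) := by
        simp only [Finset.mem_insert, Finset.mem_singleton, not_or]
        exact ⟨(hS₁ s hs.1).2.symm, (hK s).ne_left.symm⟩
      have h1 := mem_subcube.1 hy s.2 hi
      have h2 := mem_subcube.1 hy' s.2 hi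
      rw [h1] at h2
      cases c <;> cases c' <;> simp [X] at h2 hne)
  -- second round: the face in the directions `s.2, K s` through the edge
  have hsub₂ : ∀ s y, y ∈ subcube {s.2, K s} s.1 → y ∈ subcube (D s) s.1 := fun s y hy =>
    subcube_mono (by intro a ha; simp only [D, Finset.mem_insert, Finset.mem_singleton] at ha ⊢
                     tauto) _ hy
  have hval₂ : ∀ s ∈ S₁, ∀ y ∈ subcube {s.2, K s} s.1, g₁ y s.2 = σ s.2 ∧ g₁ y (K s) = σ (J s) := by
    intro s hs y hy
    constructor
    · refine hg₁off y s.2 fun t ht hyt => ?_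
      have hst : t.1 = s := huniq' _ (hS₁ _ (Finset.mem_product.1 ht).1).1 s (hS₁ s hs).1 y
        (hXsub t y hyt) (hsub₂ s y hy)
      rw [hst]
      simp only [Finset.mem_insert, Finset.mem_singleton, not_or]
      exact ⟨(hS₁ s hs).2.symm, (hK s).ne_left.symm⟩
    · have key : ∀ c : Bool, ∀ y ∈ subcube {J s, K s} (X (s, c)), g₁ y (K s) = σ (J s) :=
        fun c y hy => (hg₁face (s, c) (Finset.mem_product.2 ⟨hs, Finset.mem_univ _⟩) y hy).2
      have hk : K s ∈ ({J s, K s} : Finset (Fin d)) := by simp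
      rcases mem_face_iff.1 hy with (rfl | rfl) | (rfl | rfl)
      · exact key false _ (self_mem_subcube _ _)
      · exact key true _ (self_mem_subcube _ _)
      · exact key false _ ((flipAt_mem_subcube hk).2 (self_mem_subcube _ _))
      · exact key true _ ((flipAt_mem_subcube hk).2 (self_mem_subcube _ _))
  obtain ⟨g, hg, hgface, hgoff⟩ := hg₁.exists_swapFaces S₁ Prod.fst Prod.snd K (by
      intro s hs y hy
      have h1 := hval₂ s hs y hy
      have h2 := hval₂ s hs s.1 (self_mem_subcube _ _)
      exact ⟨h1.1.trans h2.1.symm, h1.2.trans h2.2.symm⟩) (by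
      intro s hs s' hs' hne y hy hy'
      exact absurd (huniq' s (hS₁ s hs).1 s' (hS₁ s' hs').1 y (hsub₂ s y hy) (hsub₂ s' y hy')) hne)
  have hgval : ∀ s ∈ S₁, ∀ y ∈ subcube {s.2, K s} s.1, g y s.2 = σ (J s) ∧ g y (K s) = σ s.2 := by
    intro s hs y hy
    have h1 := hgface s hs y hy
    have h2 := hval₂ s hs s.1 (self_mem_subcube _ _)
    exact ⟨h1.1.trans h2.2, h1.2.trans h2.1⟩
  -- the colors of all edges changed by the two rounds
  have hchanged : ∀ y a, g y a ≠ σ a → ∃ s ∈ S₁, y ∈ subcube (D s) s.1 ∧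
      ((a = s.2 ∧ y ∈ subcube {s.2, K s} s.1 ∧ g y a = σ (J s)) ∨
        (a = K s ∧ (g y a = σ s.2 ∨ g y a = σ (J s))) ∨
        (a = J s ∧ (∃ c, y ∈ subcube {J s, K s} (X (s, c))) ∧ g y a = σ (K s))) := by
    intro y a hya
    by_cases h2 : ∃ s ∈ S₁, y ∈ subcube {s.2, K s} s.1 ∧ a ∈ ({s.2, K s} : Finset (Fin d))
    · obtain ⟨s, hs, hy, ha⟩ := h2
      have hv := hgval s hs y hy
      refine ⟨s, hs, hsub₂ s y hy, ?_⟩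
      rw [Finset.mem_insert, Finset.mem_singleton] at ha
      rcases ha with rfl | rfl
      · exact Or.inl ⟨rfl, hy, hv.1⟩
      · exact Or.inr (Or.inl ⟨rfl, Or.inl hv.2⟩)
    · push Not at h2
      have hgg : g y a = g₁ y a := hgoff y a h2
      by_cases h1 : ∃ t ∈ S₁ ×ˢ (Finset.univ : Finset Bool), y ∈ subcube {J t.1, K t.1} (X t) ∧
          a ∈ ({J t.1, K t.1} : Finset (Fin d))
      · obtain ⟨t, ht, hy, ha⟩ := h1
        have hv := hg₁face t ht y hy
        refine ⟨t.1, (Finset.mem_product.1 ht).1, hXsub t y hy, ?_⟩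
        rw [Finset.mem_insert, Finset.mem_singleton] at ha
        rcases ha with rfl | rfl
        · exact Or.inr (Or.inr ⟨rfl, ⟨t.2, hy⟩, hgg.trans hv.1⟩)
        · exact Or.inr (Or.inl ⟨rfl, Or.inr (hgg.trans hv.2)⟩)
      · push Not at h1
        exact absurd (hgg.trans (hg₁off y a h1)) hya
  refine ⟨g, hg, fun x i hx => ?_, fun y a hya => ?_, fun x => ?_⟩
  · obtain ⟨u, hu, huP, hxu⟩ := h.exists_canonical_mem hx
    have hus : (u, i) ∈ S := (hS _).2 ⟨hu, huP⟩
    have huval : g u i = p u i := by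
      by_cases hJ : J (u, i) = i
      · -- the prescribed color is the standard one: the edge lies in no recolored face
        have hp : p u i = σ i := by rw [← hσJ (u, i), hJ]
        by_contra hne
        obtain ⟨s, hs, hy, -⟩ := hchanged u i (hp ▸ hne)
        have : s = (u, i) := huniq' s (hS₁ s hs).1 _ hus u hy (self_mem_subcube _ _)
        exact (hS₁ s hs).2 (this ▸ hJ)
      · have := (hgval (u, i) (Finset.mem_filter.2 ⟨hus, hJ⟩) u (self_mem_subcube _ _)).1
        rw [hσJ] at this
        exact this
    rcases hxu with rfl | rfl
    · exact huval
    · rw [hg.flip, h.flip, huval]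
  · obtain ⟨s, hs, hcube, hcase⟩ := hchanged y a hya
    have hsP := ((hS s).1 (hS₁ s hs).1).2
    have hKs := hK s
    rcases hcase with ⟨rfl, hy, hv⟩ | ⟨rfl, hv⟩ | ⟨rfl, ⟨c, hy⟩, hv⟩
    · rw [hv]
      have hp : σ (J s) ∉ l s.1 s.2 := hσJ s ▸ hpl _ _ hsP
      rcases mem_face_iff.1 hy with (rfl | rfl) | (rfl | rfl)
      · exact hp
      · rwa [hl.flip]
      · exact hKs.opposite
      · rw [flipAt_comm, hl.flip]
        exact hKs.opposite
    · have hD : D s = insert (K s) {s.2, J s} := by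
        ext a
        simp only [D, Finset.mem_insert, Finset.mem_singleton]
        tauto
      rw [hD] at hcube
      have key : σ (J s) ∉ l y (K s) ∧ σ s.2 ∉ l y (K s) := by
        rcases mem_subcube_insert hcube with hy | hy
        · exact hKs.spoke y hy
        · rw [← hl.flip]
          exact hKs.spoke _ hy
      rcases hv with hv | hv <;> rw [hv]
      exacts [key.2, key.1]
    · rw [hv]
      have hX : X (s, c) ∈ ({s.1, flipAt s.1 s.2} : Finset (Fin d → Bool)) := by
        cases c <;> simp [X]
      have hside := hKs.side _ hX
      rcases mem_face_iff.1 hy with (rfl | rfl) | (rfl | rfl)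
      · exact hside.1
      · rw [hl.flip]
        exact hside.1
      · exact hside.2
      · rw [flipAt_comm, hl.flip]
        exact hside.2
  · have hcube : ∀ y i, (P y i ∨ g y i ≠ σ i) → ∃ s ∈ S, y ∈ subcube (D s) s.1 ∧ i ∈ D s := by
      rintro y i (hy | hy)
      · obtain ⟨u, hu, huP, hyu⟩ := h.exists_canonical_mem hy
        refine ⟨(u, i), (hS _).2 ⟨hu, huP⟩, ?_, hiD (u, i)⟩
        rcases hyu with rfl | rfl
        · exact self_mem_subcube _ _
        · exact (flipAt_mem_subcube (hiD (u, i))).2 (self_mem_subcube _ _)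
      · obtain ⟨s, hs, hys, hcase⟩ := hchanged y i hy
        refine ⟨s, (hS₁ s hs).1, hys, ?_⟩
        rcases hcase with ⟨rfl, -⟩ | ⟨rfl, -⟩ | ⟨rfl, -⟩ <;> simp [D]
    have hnear : ∀ y, hammingDist x y ≤ 2 → ∀ s, y ∈ subcube (D s) s.1 →
        hammingDist x s.1 ≤ 5 := by
      intro y hy s hys
      have h1 := (hammingDist_le_of_mem_subcube hys).trans (hDcard s)
      rw [hammingDist_comm] at h1
      have h2 := hammingDist_triangle x y s.1
      omega
    by_cases hs : ∃ s ∈ S, hammingDist x s.1 ≤ 5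
    · obtain ⟨s, hs, hxs⟩ := hs
      refine ⟨subcube (D s) s.1 ×ˢ D s, ?_, fun y i hy hyi => ?_⟩
      · rw [Finset.card_product]
        exact Nat.mul_le_mul ((card_subcube_le _ _).trans
          (Nat.pow_le_pow_right (by norm_num) (hDcard s))) (hDcard s)
      · obtain ⟨s', hs', hys', hi⟩ := hcube y i hyi
        have h1 := hnear y hy s' hys'
        have h2 := hammingDist_triangle s.1 x s'.1
        rw [hammingDist_comm s.1 x] at h2
        obtain rfl := huniq s hs s' hs' (by omega)
        exact Finset.mem_product.2 ⟨hys', hi⟩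
    · refine ⟨∅, by simp, fun y i hy hyi => ?_⟩
      obtain ⟨s', hs', hys', -⟩ := hcube y i hyi
      exact absurd ⟨s', hs', hnear y hy s' hys'⟩ hs

end Gadgets

/-! ### Removing the conflicts with the lists -/

section Conflicts

variable {d : ℕ} {l : (Fin d → Bool) → Fin d → Finset (Fin d)} {σ : Equiv.Perm (Fin d)}
  {R : (Fin d → Bool) → Fin d → Prop}

/-- An edge `(x, i)` is called a conflict edge if its standard color `σ i` is in its list. This
predicate describes the directions `j` that are suitable for removing the conflict at `(x, i)`,
where `R` is the set of reserved edges, which have to keep their colors: the face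
through the edge in the directions `i, j` has no other conflict edge and no reserved edge, and
interchanging its two colors gives none of its edges a forbidden color. -/
structure SwapDirection (l : (Fin d → Bool) → Fin d → Finset (Fin d)) (σ : Equiv.Perm (Fin d))
    (R : (Fin d → Bool) → Fin d → Prop) (x : Fin d → Bool) (i j : Fin d) : Prop where
  ne : j ≠ i
  edge : σ j ∉ l x i
  opposite : σ j ∉ l (flipAt x j) i
  opposite_conflict : σ i ∉ l (flipAt x j) i
  side : ∀ y ∈ ({x, flipAt x i} : Finset (Fin d → Bool)), σ i ∉ l y j ∧ σ j ∉ l y j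
  free : ∀ y ∈ subcube {i, j} x, ∀ a ∈ ({i, j} : Finset (Fin d)), ¬ R y a

/-- Most directions are suitable. The set `Q` bounds the reserved edges near `x`; in the application
these come from a single gadget. -/
theorem SparseLists.ncard_not_swapDirection_le {b m : ℕ} (hl : SparseLists b l)
    (hσ₁ : ∀ x, {j | σ j ∈ l x j}.ncard ≤ m)
    (hσ₂ : ∀ x i, {j | σ j ∈ l (flipAt x j) i}.ncard ≤ m)
    {x : Fin d → Bool} {i : Fin d} (hRflip : R (flipAt x i) i → R x i) (hR : ¬ R x i)
    {Q : Finset ((Fin d → Bool) × Fin d)} (hQcard : Q.card ≤ 24)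
    (hQ : ∀ y a, hammingDist x y ≤ 2 → R y a → (y, a) ∈ Q) :
    {j | ¬ SwapDirection l σ R x i j}.ncard ≤ 5 * b + 3 * m + 73 := by
  classical
  have h1 : {k | k = i}.ncard ≤ 1 := ncard_le_one_of_unique fun a b ha hb => ha.trans hb.symm
  have h2 := (ncard_apply_mem_le σ (l x i)).trans (hl.card_le x i)
  have h3 := hσ₂ x i
  have h4 := hl.ncard_flipAt_le x i (σ i)
  have h5 : {k | ∃ y ∈ ({x, flipAt x i} : Finset (Fin d → Bool)),
      σ i ∈ l y k ∨ σ k ∈ l y k}.ncard ≤ 2 * (b + m) := by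
    refine (ncard_exists_mem_le (n := b + m) _ _ fun y _ => ?_).trans
      (Nat.mul_le_mul_right _ Finset.card_le_two)
    have := ncard_or_le (fun k => σ i ∈ l y k) fun k => σ k ∈ l y k
    have := hl.vertex_le y (σ i)
    have := hσ₁ y
    omega
  -- a reserved edge `q` spoils at most three faces through the edge `(x, i)`
  have h6 : {k | ∃ q ∈ Q, k = q.2 ∨ q.1 = flipAt x k ∨ q.1 = flipAt (flipAt x i) k}.ncard ≤
      24 * 3 := by
    refine (ncard_exists_mem_le (n := 3) _ _ fun q _ => ?_).trans (Nat.mul_le_mul_right _ hQcard)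
    have e1 : {k | k = q.2}.ncard ≤ 1 :=
      ncard_le_one_of_unique fun a b ha hb => ha.trans hb.symm
    have e2 : {k | q.1 = flipAt x k}.ncard ≤ 1 :=
      ncard_le_one_of_unique fun a b ha hb => flipAt_injective x (ha.symm.trans hb)
    have e3 : {k | q.1 = flipAt (flipAt x i) k}.ncard ≤ 1 :=
      ncard_le_one_of_unique fun a b ha hb => flipAt_injective _ (ha.symm.trans hb)
    have e4 := ncard_or_le (fun k => q.1 = flipAt x k) fun k => q.1 = flipAt (flipAt x i) k
    have e5 := ncard_or_le (fun k => k = q.2)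
      fun k => q.1 = flipAt x k ∨ q.1 = flipAt (flipAt x i) k
    omega
  have hsub : {j | ¬ SwapDirection l σ R x i j} ⊆
      {k | k = i} ∪ {k | σ k ∈ l x i} ∪ {k | σ k ∈ l (flipAt x k) i} ∪
        {k | σ i ∈ l (flipAt x k) i} ∪
        {k | ∃ y ∈ ({x, flipAt x i} : Finset (Fin d → Bool)), σ i ∈ l y k ∨ σ k ∈ l y k} ∪
        {k | ∃ q ∈ Q, k = q.2 ∨ q.1 = flipAt x k ∨ q.1 = flipAt (flipAt x i) k} := by
    intro k hk
    by_contra hcon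
    simp only [Set.mem_union, not_or] at hcon
    obtain ⟨⟨⟨⟨⟨c1, c2⟩, c3⟩, c4⟩, c5⟩, c6⟩ := hcon
    refine hk ⟨c1, c2, c3, c4, fun y hy => ?_, fun y hy a ha hRa => c6 ?_⟩
    · by_contra hcon
      exact c5 ⟨y, hy, by tauto⟩
    · have hq := hQ y a ((hammingDist_le_of_mem_subcube hy).trans Finset.card_le_two) hRa
      refine ⟨(y, a), hq, ?_⟩
      rw [Finset.mem_insert, Finset.mem_singleton] at ha
      rcases ha with rfl | rfl
      · rcases mem_face_iff.1 hy with (rfl | rfl) | hy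
        · exact absurd hRa hR
        · exact absurd (hRflip hRa) hR
        · exact Or.inr hy
      · exact Or.inl rfl
  have := Set.ncard_le_ncard hsub
  have := Set.ncard_union_le ({k | k = i} ∪ {k | σ k ∈ l x i} ∪ {k | σ k ∈ l (flipAt x k) i} ∪
        {k | σ i ∈ l (flipAt x k) i} ∪
        {k | ∃ y ∈ ({x, flipAt x i} : Finset (Fin d → Bool)), σ i ∈ l y k ∨ σ k ∈ l y k})
        {k | ∃ q ∈ Q, k = q.2 ∨ q.1 = flipAt x k ∨ q.1 = flipAt (flipAt x i) k}
  have := Set.ncard_union_le ({k | k = i} ∪ {k | σ k ∈ l x i} ∪ {k | σ k ∈ l (flipAt x k) i} ∪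
        {k | σ i ∈ l (flipAt x k) i})
        {k | ∃ y ∈ ({x, flipAt x i} : Finset (Fin d → Bool)), σ i ∈ l y k ∨ σ k ∈ l y k}
  have := Set.ncard_union_le ({k | k = i} ∪ {k | σ k ∈ l x i} ∪ {k | σ k ∈ l (flipAt x k) i})
        {k | σ i ∈ l (flipAt x k) i}
  have := Set.ncard_union_le ({k | k = i} ∪ {k | σ k ∈ l x i}) {k | σ k ∈ l (flipAt x k) i}
  have := Set.ncard_union_le {k | k = i} {k | σ k ∈ l x i}
  omega

/-- The only conflict edge on the face of a suitable direction is the edge itself. -/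
theorem SwapDirection.eq_of_conflict {b : ℕ} (hl : SparseLists b l) {x y : Fin d → Bool}
    {i j a : Fin d} (h : SwapDirection l σ R x i j) (hy : y ∈ subcube {i, j} x)
    (ha : a ∈ ({i, j} : Finset (Fin d))) (hc : σ a ∈ l y a) :
    a = i ∧ (y = x ∨ y = flipAt x i) := by
  rw [Finset.mem_insert, Finset.mem_singleton] at ha
  rcases ha with rfl | rfl
  · refine ⟨rfl, ?_⟩
    rcases mem_face_iff.1 hy with hy | rfl | rfl
    · exact hy
    · exact absurd hc h.opposite_conflict
    · rw [flipAt_comm, hl.flip] at hc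
      exact absurd hc h.opposite_conflict
  · exfalso
    rcases mem_face_iff.1 hy with (rfl | rfl) | rfl | rfl
    · exact (h.side y (by simp)).2 hc
    · exact (h.side _ (by simp)).2 hc
    · rw [hl.flip] at hc
      exact (h.side x (by simp)).2 hc
    · rw [hl.flip] at hc
      exact (h.side _ (by simp)).2 hc

theorem eq_of_canonical {x y z : Fin d → Bool} {i : Fin d} (hx : x i = false) (hy : y i = false)
    (hzx : z = x ∨ z = flipAt x i) (hzy : z = y ∨ z = flipAt y i) : x = y := by
  rcases hzx with rfl | rfl <;> rcases hzy with h | h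
  · exact h
  · rw [h, flipAt_self, hy] at hx
    simp at hx
  · rw [← h, flipAt_self, hx] at hy
    simp at hy
  · rw [← flipAt_flipAt x i, h, flipAt_flipAt]

/-- The faces in the directions `e.2, j` through `e` and in the directions `e'.2, j'` through `e'`
have a common edge. -/
def FacesMeet (e : (Fin d → Bool) × Fin d) (j : Fin d) (e' : (Fin d → Bool) × Fin d)
    (j' : Fin d) : Prop :=
  ∃ y ∈ subcube {e.2, j} e.1, y ∈ subcube {e'.2, j'} e'.1 ∧
    ∃ a ∈ ({e.2, j} : Finset (Fin d)), a ∈ ({e'.2, j'} : Finset (Fin d))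

/-- A face chosen at a conflict edge meets few of the faces available at other conflict edges.
If the common edge is parallel to `e'`, then `e'` is one of the few nearby conflict edges of
direction `i` or `j`, and the common edge determines the face; otherwise `e'` is one of the few
conflict edges at a vertex of the given face. -/
theorem SwapDirection.ncard_facesMeet_le {b m : ℕ} (hl : SparseLists b l)
    (hσ₁ : ∀ x, {j | σ j ∈ l x j}.ncard ≤ m) {x : Fin d → Bool} {i j : Fin d}
    (h : SwapDirection l σ R x i j) (hxi : x i = false) :
    {q : ((Fin d → Bool) × Fin d) × Fin d | q.1 ≠ (x, i) ∧ q.1.1 q.1.2 = false ∧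
      σ q.1.2 ∈ l q.1.1 q.1.2 ∧ FacesMeet (x, i) j q.1 q.2}.ncard ≤ 32 * b + 8 * m := by
  classical
  let pA : Fin d → (Fin d → Bool) → ((Fin d → Bool) × Fin d) × Fin d → Prop := fun a y q =>
    q.1.2 = a ∧ (hammingDist x q.1.1 ≤ 6 ∧ σ a ∈ l q.1.1 a) ∧ y = flipAt q.1.1 q.2
  let pB : Fin d → (Fin d → Bool) → ((Fin d → Bool) × Fin d) × Fin d → Prop := fun a y q =>
    q.1.2 = a ∧ (hammingDist x q.1.1 ≤ 6 ∧ σ a ∈ l q.1.1 a) ∧ y = flipAt (flipAt q.1.1 a) q.2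
  let pC : Fin d → (Fin d → Bool) → ((Fin d → Bool) × Fin d) × Fin d → Prop := fun a y q =>
    q.2 = a ∧ q.1.1 q.1.2 = false ∧ (y = q.1.1 ∨ y = flipAt q.1.1 q.1.2) ∧ σ q.1.2 ∈ l y q.1.2
  have hA : ∀ a y, {q | pA a y q}.ncard ≤ 2 * b := by
    intro a y
    refine (Set.ncard_le_ncard_of_injOn (t := {z | hammingDist x z ≤ 6 ∧ σ a ∈ l z a})
      (fun q => q.1.1) (fun q hq => hq.2.1) ?_).trans (hl.near_le x a (σ a))
    rintro ⟨⟨z, c⟩, k⟩ ⟨hq1, -, hq2⟩ ⟨⟨z', c'⟩, k'⟩ ⟨hq1', -, hq2'⟩ hzz'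
    simp only at hq1 hq2 hq1' hq2' hzz'
    subst hzz' hq1 hq1'
    rw [flipAt_injective _ (hq2.symm.trans hq2')]
  have hB : ∀ a y, {q | pB a y q}.ncard ≤ 2 * b := by
    intro a y
    refine (Set.ncard_le_ncard_of_injOn (t := {z | hammingDist x z ≤ 6 ∧ σ a ∈ l z a})
      (fun q => q.1.1) (fun q hq => hq.2.1) ?_).trans (hl.near_le x a (σ a))
    rintro ⟨⟨z, c⟩, k⟩ ⟨hq1, -, hq2⟩ ⟨⟨z', c'⟩, k'⟩ ⟨hq1', -, hq2'⟩ hzz'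
    simp only at hq1 hq2 hq1' hq2' hzz'
    subst hzz' hq1 hq1'
    rw [flipAt_injective _ (hq2.symm.trans hq2')]
  have hC : ∀ a y, {q | pC a y q}.ncard ≤ m := by
    intro a y
    refine (Set.ncard_le_ncard_of_injOn (t := {c | σ c ∈ l y c})
      (fun q => q.1.2) (fun q hq => hq.2.2.2) ?_).trans (hσ₁ y)
    rintro ⟨⟨z, c⟩, k⟩ ⟨hq1, hz, hzy, -⟩ ⟨⟨z', c'⟩, k'⟩ ⟨hq1', hz', hzy', -⟩ hcc'
    simp only at hq1 hz hzy hq1' hz' hzy' hcc'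
    subst hcc' hq1 hq1'
    rw [eq_of_canonical hz hz' hzy hzy']
  have hsub : {q : ((Fin d → Bool) × Fin d) × Fin d | q.1 ≠ (x, i) ∧ q.1.1 q.1.2 = false ∧
      σ q.1.2 ∈ l q.1.1 q.1.2 ∧ FacesMeet (x, i) j q.1 q.2} ⊆
      {q | ∃ a ∈ ({i, j} : Finset (Fin d)), ∃ y ∈ subcube {i, j} x,
        pA a y q ∨ pB a y q ∨ pC a y q} := by
    rintro ⟨⟨x', i'⟩, j'⟩ ⟨hne, hx', hc, y, hy, hy', a, ha, ha'⟩
    simp only at hne hx' hc hy hy' ha ha'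
    have hnear : hammingDist x x' ≤ 6 := by
      have h1 := (hammingDist_le_of_mem_subcube hy).trans Finset.card_le_two
      have h2 := (hammingDist_le_of_mem_subcube hy').trans Finset.card_le_two
      rw [hammingDist_comm] at h2
      have h3 := hammingDist_triangle x y x'
      omega
    by_cases hai : a = i'
    · subst hai
      rcases mem_face_iff.1 hy' with hyx | hyx
      · exfalso
        have hcy : σ a ∈ l y a := by
          rcases hyx with rfl | rfl
          · exact hc
          · rwa [hl.flip]
        obtain ⟨rfl, hyx'⟩ := h.eq_of_conflict hl hy ha hcy
        exact hne (by rw [eq_of_canonical hx' hxi hyx hyx'])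
      · refine ⟨a, ha, y, hy, ?_⟩
        rcases hyx with hyx | hyx
        · exact Or.inl ⟨rfl, ⟨hnear, hc⟩, hyx⟩
        · exact Or.inr (Or.inl ⟨rfl, ⟨hnear, hc⟩, hyx⟩)
    · have haj : a = j' := by
        rw [Finset.mem_insert, Finset.mem_singleton] at ha'
        tauto
      subst haj
      have key : ∀ z ∈ subcube {i, j} x, (z = x' ∨ z = flipAt x' i') →
          pC a z ((x', i'), a) := by
        intro z _ hz'
        refine ⟨rfl, hx', hz', ?_⟩
        rcases hz' with rfl | rfl
        · exact hc
        · change σ i' ∈ l (flipAt x' i') i'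
          rwa [hl.flip]
      rcases mem_face_iff.1 hy' with hyx | hyx
      · exact ⟨a, ha, y, hy, Or.inr (Or.inr (key y hy hyx))⟩
      · have hz := (flipAt_mem_subcube ha).2 hy
        refine ⟨a, ha, flipAt y a, hz, Or.inr (Or.inr (key _ hz ?_))⟩
        rcases hyx with rfl | rfl <;> simp
  refine (Set.ncard_le_ncard hsub).trans ?_
  have hall : ∀ a ∈ ({i, j} : Finset (Fin d)), {q | ∃ y ∈ subcube {i, j} x,
      pA a y q ∨ pB a y q ∨ pC a y q}.ncard ≤ 4 * (4 * b + m) := by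
    intro a _
    refine (ncard_exists_mem_le (n := 4 * b + m) _ _ fun y _ => ?_).trans
      (Nat.mul_le_mul_right _ ((card_subcube_le _ _).trans
        (Nat.pow_le_pow_right (by norm_num) Finset.card_le_two)))
    have e1 := ncard_or_le (pB a y) (pC a y)
    have e2 := ncard_or_le (pA a y) fun q => pB a y q ∨ pC a y q
    have := hA a y
    have := hB a y
    have := hC a y
    omega
  have := (ncard_exists_mem_le ({i, j} : Finset (Fin d)) _ hall).trans
    (Nat.mul_le_mul_right _ (Finset.card_le_two (a := i) (b := j)))
  omega

/-- The coloring in the encoding of edges as pairs: starting from the coloring of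
`SeparatedPrecoloring.exists_gadgets`, each remaining conflict is removed by interchanging the
colors of a face through the conflict edge, and these faces are chosen edge-disjoint by an
independent transversal. -/
theorem SeparatedPrecoloring.exists_extension_avoiding {P : (Fin d → Bool) → Fin d → Prop}
    {p : (Fin d → Bool) → Fin d → Fin d} (h : SeparatedPrecoloring P p) {b m : ℕ}
    (hl : SparseLists b l) (hpl : ∀ x i, P x i → p x i ∉ l x i)
    (hσ₁ : ∀ x, {j | σ j ∈ l x j}.ncard ≤ m)
    (hσ₂ : ∀ x i, {j | σ j ∈ l (flipAt x j) i}.ncard ≤ m)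
    (hd : 133 * b + 35 * m + 74 ≤ d) :
    ∃ g : (Fin d → Bool) → Fin d → Fin d, IsProperColoring g ∧
      (∀ x i, P x i → g x i = p x i) ∧ ∀ x i, g x i ∉ l x i := by
  classical
  obtain ⟨g, hg, hgP, hgl, hgQ⟩ := h.exists_gadgets hl hpl hσ₂ (by omega)
  let R : (Fin d → Bool) → Fin d → Prop := fun x i => P x i ∨ g x i ≠ σ i
  have hRflip : ∀ x i, R (flipAt x i) i → R x i := by
    rintro x i (hP | hne)
    · have := h.flip_mem _ _ hP
      rw [flipAt_flipAt] at this
      exact Or.inl this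
    · rw [hg.flip] at hne
      exact Or.inr hne
  have hRflip' : ∀ x i, R x i → R (flipAt x i) i := by
    intro x i hR
    exact hRflip _ _ (by rwa [flipAt_flipAt])
  let C : Finset ((Fin d → Bool) × Fin d) :=
    Finset.univ.filter fun e => e.1 e.2 = false ∧ ¬ R e.1 e.2 ∧ σ e.2 ∈ l e.1 e.2
  have hC : ∀ e, e ∈ C ↔ e.1 e.2 = false ∧ ¬ R e.1 e.2 ∧ σ e.2 ∈ l e.1 e.2 := fun e => by
    simp [C]
  let A : (Fin d → Bool) × Fin d → Finset (Fin d) := fun e =>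
    Finset.univ.filter fun j => SwapDirection l σ R e.1 e.2 j
  have hA : ∀ e j, j ∈ A e ↔ SwapDirection l σ R e.1 e.2 j := fun e j => by simp [A]
  have hAcard : ∀ e ∈ C, 4 * (32 * b + 8 * m) + 1 ≤ (A e).card := by
    intro e he
    obtain ⟨-, hR, -⟩ := (hC e).1 he
    obtain ⟨Q, hQcard, hQ⟩ := hgQ e.1
    have h1 := hl.ncard_not_swapDirection_le (R := R) hσ₁ hσ₂ (hRflip e.1 e.2) hR hQcard hQ
    have h2 : {j | ¬ SwapDirection l σ R e.1 e.2 j}.ncard = d - (A e).card := by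
      have : {j | ¬ SwapDirection l σ R e.1 e.2 j} = ((A e)ᶜ : Finset (Fin d)) := by
        ext j
        simp [A]
      rw [this, Set.ncard_coe_finset, Finset.card_compl, Fintype.card_fin]
    have h3 : (A e).card ≤ d := (Finset.card_le_univ _).trans_eq (Fintype.card_fin d)
    omega
  have : Nonempty (Fin d) := ⟨⟨0, by omega⟩⟩
  obtain ⟨τ, hτA, hτ⟩ := exists_independent_transversal (C := C) (A := A) (conf := FacesMeet)
    (N := 4 * (32 * b + 8 * m) + 1) (Δ := 32 * b + 8 * m)
    (by
      rintro e j e' j' ⟨y, hy, hy', a, ha, ha'⟩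
      exact ⟨y, hy', hy, a, ha', ha⟩)
    hAcard (by omega) (by omega) (by
      rintro ⟨x, i⟩ he j hj
      obtain ⟨hxi, -, -⟩ := (hC _).1 he
      have hle := ((hA _ _).1 hj).ncard_facesMeet_le hl hσ₁ hxi
      rw [Set.ncard_eq_toFinset_card _ (Set.toFinite _)] at hle
      refine ⟨_, hle, fun e' he' hne j' _ hmeet => ?_⟩
      obtain ⟨h1, -, h2⟩ := (hC _).1 he'
      rw [Set.Finite.mem_toFinset]
      exact ⟨hne, h1, h2, hmeet⟩)
  have hτS : ∀ e ∈ C, SwapDirection l σ R e.1 e.2 (τ e) := fun e he => (hA _ _).1 (hτA e he)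
  have hgσ : ∀ e ∈ C, ∀ y ∈ subcube {e.2, τ e} e.1, ∀ a ∈ ({e.2, τ e} : Finset (Fin d)),
      g y a = σ a := by
    intro e he y hy a ha
    by_contra hne
    exact (hτS e he).free y hy a ha (Or.inr hne)
  obtain ⟨f, hf, hfface, hfoff⟩ := hg.exists_swapFaces C Prod.fst Prod.snd τ
    (by
      intro e he y hy
      have hX := self_mem_subcube {e.2, τ e} e.1
      rw [hgσ e he y hy _ (by simp), hgσ e he y hy _ (by simp), hgσ e he _ hX _ (by simp),
        hgσ e he _ hX _ (by simp)]
      exact ⟨rfl, rfl⟩)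
    (by
      intro e he e' he' hne y hy hy' a ha ha'
      exact hτ e he e' he' hne.symm ⟨y, hy, hy', a, ha, ha'⟩)
  refine ⟨f, hf, fun x i hx => ?_, fun x a => ?_⟩
  · rw [hfoff x i fun e he hxe hi => (hτS e he).free x hxe i hi (Or.inl hx), hgP x i hx]
  · by_cases hex : ∃ e ∈ C, x ∈ subcube {e.2, τ e} e.1 ∧ a ∈ ({e.2, τ e} : Finset (Fin d))
    · obtain ⟨e, he, hxe, ha⟩ := hex
      have hv := hfface e he x hxe
      have hX := self_mem_subcube {e.2, τ e} e.1
      rw [hgσ e he _ hX _ (by simp), hgσ e he _ hX _ (by simp)] at hv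
      have hs := hτS e he
      rw [Finset.mem_insert, Finset.mem_singleton] at ha
      rcases ha with rfl | rfl
      · rw [hv.1]
        rcases mem_face_iff.1 hxe with (rfl | rfl) | (rfl | rfl)
        · exact hs.edge
        · rw [hl.flip]
          exact hs.edge
        · exact hs.opposite
        · rw [flipAt_comm, hl.flip]
          exact hs.opposite
      · rw [hv.2]
        rcases mem_face_iff.1 hxe with (rfl | rfl) | (rfl | rfl)
        · exact (hs.side _ (by simp)).1
        · exact (hs.side _ (by simp)).1
        · rw [hl.flip]
          exact (hs.side _ (by simp)).1
        · rw [hl.flip]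
          exact (hs.side _ (by simp)).1
    · push Not at hex
      rw [hfoff x a hex]
      by_cases hR : R x a
      · by_cases hP : P x a
        · rw [hgP x a hP]
          exact hpl x a hP
        · exact hgl x a (hR.resolve_left hP)
      · have hgx : g x a = σ a := by
          by_contra hne
          exact hR (Or.inr hne)
        rw [hgx]
        intro hc
        obtain ⟨u, hu, hxu⟩ := exists_canonical x a
        have huC : (u, a) ∈ C := by
          rw [hC]
          rcases hxu with rfl | rfl
          · exact ⟨hu, hR, hc⟩
          · rw [hl.flip] at hc
            exact ⟨hu, fun h' => hR (hRflip' _ _ h'), hc⟩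
        refine hex (u, a) huC (mem_face_iff.2 (Or.inl hxu)) (by simp)

end Conflicts

/-! ### Translation to edges of the hypercube -/

section Interface

variable {d : ℕ}

/-- The edge between `x` and `flipAt x i`. -/
def dirEdge (x : Fin d → Bool) (i : Fin d) : (hypercube d).edgeSet :=
  ⟨s(x, flipAt x i), hammingDist_flipAt x i⟩

theorem coe_dirEdge (x : Fin d → Bool) (i : Fin d) :
    (dirEdge x i : Sym2 (Fin d → Bool)) = s(x, flipAt x i) := rfl

theorem exists_eq_flipAt {x y : Fin d → Bool} (h : (hypercube d).Adj x y) :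
    ∃ i, y = flipAt x i := by
  change hammingDist x y = 1 at h
  rw [hammingDist, Finset.card_eq_one] at h
  obtain ⟨i, hi⟩ := h
  have key : ∀ l, x l ≠ y l ↔ l = i := fun l => by
    have := Finset.ext_iff.1 hi l
    simpa using this
  refine ⟨i, funext fun l => ?_⟩
  by_cases hl : l = i
  · subst hl
    rw [flipAt_self]
    have := (key l).2 rfl
    revert this
    cases x l <;> cases y l <;> simp
  · rw [flipAt_of_ne x hl]
    by_contra hne
    exact hl ((key l).1 (Ne.symm hne))

theorem exists_dirEdge (e : (hypercube d).edgeSet) : ∃ x i, e = dirEdge x i := by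
  obtain ⟨e, he⟩ := e
  induction e using Sym2.ind with
  | _ x y =>
    obtain ⟨i, rfl⟩ := exists_eq_flipAt (x := x) (y := y) he
    exact ⟨x, i, rfl⟩

theorem dirEdge_flipAt (x : Fin d → Bool) (i : Fin d) : dirEdge (flipAt x i) i = dirEdge x i := by
  refine Subtype.ext ?_
  rw [coe_dirEdge, coe_dirEdge, flipAt_flipAt, Sym2.eq_swap]

theorem dirEdge_eq {x y : Fin d → Bool} {i j : Fin d} (h : dirEdge x i = dirEdge y j) :
    i = j ∧ (y = x ∨ y = flipAt x i) := by
  have h' := congrArg Subtype.val h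
  rw [coe_dirEdge, coe_dirEdge, Sym2.eq_iff] at h'
  rcases h' with ⟨rfl, h2⟩ | ⟨h1, h2⟩
  · exact ⟨flipAt_injective x h2, Or.inl rfl⟩
  · refine ⟨?_, Or.inr h2.symm⟩
    subst h2
    apply flipAt_injective (flipAt x i)
    rw [flipAt_flipAt]
    exact h1

theorem edist_le_hammingDist (x y : Fin d → Bool) :
    (hypercube d).edist x y ≤ hammingDist x y := by
  induction hn : hammingDist x y generalizing x with
  | zero =>
    rw [hammingDist_eq_zero] at hn
    subst hn
    simp
  | succ n ih =>
    have hne : x ≠ y := by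
      rintro rfl
      simp at hn
    obtain ⟨i, hi⟩ := Function.ne_iff.1 hne
    have hcard : hammingDist (flipAt x i) y = n := by
      have : (Finset.univ.filter fun l => flipAt x i l ≠ y l) =
          (Finset.univ.filter fun l => x l ≠ y l).erase i := by
        ext l
        by_cases hl : l = i
        · subst hl
          simp only [Finset.mem_filter, Finset.mem_univ, true_and, flipAt_self, Finset.mem_erase]
          revert hi
          cases x l <;> cases y l <;> simp
        · simp [flipAt_of_ne x hl, hl]
      rw [hammingDist] at hn ⊢
      rw [this, Finset.card_erase_of_mem (by simpa using hi), hn]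
      rfl
    have h1 : (hypercube d).edist x (flipAt x i) ≤ 1 := by
      rw [SimpleGraph.edist_eq_one_iff_adj.2 (hammingDist_flipAt x i)]
    calc (hypercube d).edist x y
        ≤ (hypercube d).edist x (flipAt x i) + (hypercube d).edist (flipAt x i) y :=
          SimpleGraph.edist_triangle
      _ ≤ 1 + n := add_le_add h1 (ih _ hcard)
      _ = ((n + 1 : ℕ) : ℕ∞) := by push_cast; ring

theorem edgeDist_dirEdge_le (x y : Fin d → Bool) (i j : Fin d) :
    edgeDist (hypercube d) (dirEdge x i) (dirEdge y j) ≤ hammingDist x y :=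
  (iInf₂_le_of_le x (Sym2.mem_mk_left _ _) (iInf₂_le_of_le y (Sym2.mem_mk_left _ _) le_rfl)).trans
    (edist_le_hammingDist x y)

/-- The matching formed by all edges of direction `i`. -/
def directionMatching (i : Fin d) : (hypercube d).Subgraph where
  verts := Set.univ
  Adj x y := y = flipAt x i
  adj_sub := by
    rintro x y rfl
    exact hammingDist_flipAt x i
  edge_vert _ := Set.mem_univ _
  symm := ⟨by
    rintro x y rfl
    exact (flipAt_flipAt x i).symm⟩

theorem dirEdge_mem_directionMatching (x : Fin d → Bool) (i : Fin d) :
    (dirEdge x i : Sym2 (Fin d → Bool)) ∈ (directionMatching i).edgeSet := by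
  rw [coe_dirEdge, SimpleGraph.Subgraph.mem_edgeSet]
  rfl

theorem hammingDist_eq_add {n : ℕ} (i : Fin (n + 1)) (x y : Fin (n + 1) → Bool) :
    hammingDist x y = (if x i ≠ y i then 1 else 0) +
      hammingDist (i.removeNth x) (i.removeNth y) := by
  simp only [hammingDist, Finset.card_filter]
  rw [Fin.sum_univ_succAbove _ i]
  rfl

theorem isDimensionalMatching_directionMatching (i : Fin d) :
    IsDimensionalMatching (directionMatching i) := by
  refine ⟨⟨fun x _ => ⟨flipAt x i, rfl, fun y hy => hy⟩, fun x => Set.mem_univ x⟩, ?_⟩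
  obtain _ | n := d
  · exact i.elim0
  have hadj : ∀ x y : Fin (n + 1) → Bool,
      ((hypercube (n + 1)).deleteEdges (directionMatching i).edgeSet).Adj x y ↔
        x i = y i ∧ hammingDist (i.removeNth x) (i.removeNth y) = 1 := by
    intro x y
    rw [SimpleGraph.deleteEdges_adj, SimpleGraph.Subgraph.mem_edgeSet]
    change hammingDist x y = 1 ∧ ¬ y = flipAt x i ↔ _
    have hsum := hammingDist_eq_add i x y
    constructor
    · rintro ⟨h1, h2⟩
      obtain ⟨j, rfl⟩ := exists_eq_flipAt (d := n + 1) h1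
      have hij : i ≠ j := by
        rintro rfl
        exact h2 rfl
      have hi : x i = flipAt x j i := (flipAt_of_ne x hij).symm
      refine ⟨hi, ?_⟩
      rw [if_neg (not_not.2 hi)] at hsum
      omega
    · rintro ⟨hi, h1⟩
      rw [if_neg (not_not.2 hi)] at hsum
      refine ⟨by omega, ?_⟩
      rintro rfl
      simp at hi
  refine ⟨⟨((Fin.insertNthEquiv (fun _ => Bool) i).symm.trans (Equiv.boolProdEquivSum _)), ?_⟩⟩
  intro x y
  rw [hadj]
  simp only [Equiv.trans_apply, Fin.insertNthEquiv_symm_apply]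
  cases hx : x i <;> cases hy : y i <;> simp [Equiv.boolProdEquivSum, hypercube]

/-- Sparseness in the encoding of edges as pairs; only the matchings formed by all edges of one
direction are needed from the condition on dimensional matchings. -/
theorem IsSparse.sparseLists {β : ℝ} {L : ListAssignment d} (hL : IsSparse β L) {b : ℕ}
    (hb : ∀ n : ℕ, (n : ℝ) ≤ β * d → n ≤ b) : SparseLists b fun x i => L (dirEdge x i) := by
  refine ⟨fun x i => by rw [dirEdge_flipAt], fun x i => hb _ (hL.card_le _), fun x c => ?_,
    fun x i c => ?_⟩
  · refine le_trans ?_ (hb _ (hL.vertex_le x c))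
    refine ncard_le_of_injective (dirEdge x) (fun i j hij => (dirEdge_eq hij).1) fun i hi => ?_
    exact ⟨Sym2.mem_mk_left _ _, hi⟩
  · have hle := hb _ (hL.neighborhood_le (dirEdge x i) (directionMatching i)
      (isDimensionalMatching_directionMatching i) c)
    -- each edge of direction `i` is counted once for each of the two values of the coordinate `i`
    have key : ∀ v : Bool, {y | y i = v ∧ hammingDist x y ≤ 6 ∧ c ∈ L (dirEdge y i)}.ncard ≤ b := by
      intro v
      refine le_trans ?_ hle
      refine Set.ncard_le_ncard_of_injOn (fun y => dirEdge y i) ?_ ?_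
      · rintro y ⟨-, hy, hc⟩
        refine ⟨?_, dirEdge_mem_directionMatching y i, hc⟩
        refine (edgeDist_dirEdge_le x y i i).trans ?_
        exact_mod_cast hy.trans (by norm_num)
      · rintro y ⟨hy, -⟩ z ⟨hz, -⟩ hyz
        rcases (dirEdge_eq hyz).2 with h | h
        · exact h.symm
        · rw [h, flipAt_self, hy] at hz
          simp at hz
    have h1 := key false
    have h2 := key true
    have h3 := ncard_or_le (fun y => y i = false ∧ hammingDist x y ≤ 6 ∧ c ∈ L (dirEdge y i))
      fun y => y i = true ∧ hammingDist x y ≤ 6 ∧ c ∈ L (dirEdge y i)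
    refine le_trans (Set.ncard_le_ncard ?_) (h3.trans (by omega))
    rintro y ⟨hy, hc⟩
    cases hyi : y i
    · exact Or.inl ⟨hyi, hy, hc⟩
    · exact Or.inr ⟨hyi, hy, hc⟩

theorem IsDistanceMatching.separatedPrecoloring {t : ℕ} {M : (hypercube d).Subgraph}
    (hM : IsDistanceMatching t M) (ht : 12 < t) (p : (hypercube d).edgeSet → Fin d) :
    SeparatedPrecoloring (fun x i => (dirEdge x i : Sym2 (Fin d → Bool)) ∈ M.edgeSet)
      fun x i => p (dirEdge x i) := by
  refine ⟨fun x i hx => ?_, fun x i => by rw [dirEdge_flipAt], fun x i y j hx hy hd => ?_⟩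
  · rwa [dirEdge_flipAt]
  · by_contra hne
    have h1 := hM.2 _ hx _ hy fun h => hne (dirEdge_eq (Subtype.ext h))
    have h2 := h1.trans (edgeDist_dirEdge_le x y i j)
    have h3 : t ≤ hammingDist x y := by exact_mod_cast h2
    omega

theorem IsProperColoring.exists_coloring {g : (Fin d → Bool) → Fin d → Fin d}
    (hg : IsProperColoring g) : ∃ f : ProperEdgeColoring d, ∀ x i, f (dirEdge x i) = g x i := by
  choose X I hXI using exists_dirEdge (d := d)
  have hval : ∀ x i, g (X (dirEdge x i)) (I (dirEdge x i)) = g x i := by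
    intro x i
    obtain ⟨h1, h2 | h2⟩ := dirEdge_eq (hXI (dirEdge x i))
    · rw [h2, ← h1]
    · rw [h2, ← h1, hg.flip]
  refine ⟨SimpleGraph.Coloring.mk (fun e => g (X e) (I e)) ?_, hval⟩
  intro e e' hadj heq
  obtain ⟨hne, v, hv, hv'⟩ := hadj
  have key : ∀ e : (hypercube d).edgeSet, v ∈ (e : Sym2 (Fin d → Bool)) →
      ∃ i, e = dirEdge v i := by
    intro e hve
    obtain ⟨x, i, rfl⟩ := exists_dirEdge e
    rw [coe_dirEdge, Sym2.mem_iff] at hve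
    rcases hve with rfl | rfl
    · exact ⟨i, rfl⟩
    · exact ⟨i, (dirEdge_flipAt x i).symm⟩
  obtain ⟨i, rfl⟩ := key e hv
  obtain ⟨j, rfl⟩ := key e' hv'
  rw [hval, hval] at heq
  exact hne (by rw [hg.injective v heq])

/-- A permutation of the colors for which the standard coloring has few conflicts around each
vertex and each edge. -/
theorem SparseLists.exists_perm {b : ℕ} {l : (Fin d → Bool) → Fin d → Finset (Fin d)}
    (hl : SparseLists b l) (hbd : 300 * 4 ^ 100 * b ≤ d) :
    ∃ σ : Equiv.Perm (Fin d), (∀ x, {j | σ j ∈ l x j}.ncard ≤ d / 100 + 1) ∧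
      ∀ x i, {j | σ j ∈ l (flipAt x j) i}.ncard ≤ d / 100 + 1 := by
  classical
  set m := d / 100 + 1 with hm
  have hdm : d ≤ 100 * m := by omega
  let B : (Fin d → Bool) ⊕ ((Fin d → Bool) × Fin d) → Fin d → Finset (Fin d) := fun t j =>
    Sum.elim (fun x => l x j) (fun q => l (flipAt q.1 j) q.2) t
  have hcount : Fintype.card ((Fin d → Bool) ⊕ ((Fin d → Bool) × Fin d)) * b ^ m < m.factorial := by
    have h1 : Fintype.card ((Fin d → Bool) ⊕ ((Fin d → Bool) × Fin d)) ≤ (4 ^ 100) ^ m := by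
      have h2 : d + 1 ≤ 2 ^ d := Nat.lt_two_pow_self
      calc Fintype.card ((Fin d → Bool) ⊕ ((Fin d → Bool) × Fin d))
          = 2 ^ d * (d + 1) := by
            simp only [Fintype.card_sum, Fintype.card_prod, Fintype.card_pi, Fintype.card_bool,
              Fintype.card_fin, Finset.prod_const, Finset.card_univ]
            ring
        _ ≤ 2 ^ d * 2 ^ d := Nat.mul_le_mul_left _ h2
        _ = 4 ^ d := by rw [← mul_pow]; norm_num
        _ ≤ 4 ^ (100 * m) := Nat.pow_le_pow_right (by norm_num) hdm
        _ = (4 ^ 100) ^ m := pow_mul _ _ _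
    have h3 : 3 * 4 ^ 100 * b < m := by omega
    refine Nat.lt_of_mul_lt_mul_left (a := 3 ^ m) ?_
    calc 3 ^ m * (Fintype.card ((Fin d → Bool) ⊕ ((Fin d → Bool) × Fin d)) * b ^ m)
        ≤ 3 ^ m * ((4 ^ 100) ^ m * b ^ m) :=
          Nat.mul_le_mul_left _ (Nat.mul_le_mul_right _ h1)
      _ = (3 * 4 ^ 100 * b) ^ m := by rw [mul_pow, mul_pow, mul_assoc]
      _ < m ^ m := Nat.pow_lt_pow_left h3 (by omega)
      _ ≤ 3 ^ m * m.factorial := pow_self_le_three_pow_mul_factorial m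
  obtain ⟨σ, hσ⟩ := exists_perm_card_lt B (b := b) (m := m)
    (by rintro (x | q) j <;> exact hl.card_le _ _) hcount
  have key : ∀ t, {j | σ j ∈ B t j}.ncard ≤ m := by
    intro t
    refine le_trans (le_of_eq ?_) (hσ t).le
    rw [← Set.ncard_coe_finset]
    congr 1
    ext j
    simp
  exact ⟨σ, fun x => key (Sum.inl x), fun x i => key (Sum.inr (x, i))⟩

end Interface

theorem mainTheorem2 :
    ∃ β : ℝ, 0 < β ∧
      ∀ (d t : ℕ) (L : ListAssignment d) (φ : EdgePrecoloring d) (M : (hypercube d).Subgraph),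
        55 < t →
        IsSparse β L →
        IsDistanceMatching t M →
        (∀ e, φ e ≠ none ↔ (e : Sym2 (Fin d → Bool)) ∈ M.edgeSet) →
        (∀ e c, φ e = some c → c ∉ L e) →
        ∃ f : ProperEdgeColoring d, f.Extends φ ∧ f.Avoids L := by
  refine ⟨1 / (300 * 4 ^ 100), by positivity, fun d t L φ M ht hL hM hφM hφL => ?_⟩
  obtain rfl | hdpos := Nat.eq_zero_or_pos d
  · -- the cube `Q_0` has no edges
    have hno : ∀ e : (hypercube 0).edgeSet, False := fun e => by
      obtain ⟨-, i, -⟩ := exists_dirEdge e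
      exact i.elim0
    exact ⟨SimpleGraph.Coloring.mk (fun e => (hno e).elim) fun {e} => (hno e).elim,
      fun e => (hno e).elim, fun e => (hno e).elim⟩
  have hb : ∀ n : ℕ, (n : ℝ) ≤ 1 / (300 * 4 ^ 100) * d → n ≤ d / (300 * 4 ^ 100) := by
    intro n hn
    rw [one_div_mul_eq_div, le_div_iff₀ (by positivity)] at hn
    rw [Nat.le_div_iff_mul_le (by positivity)]
    exact_mod_cast hn
  have hl := hL.sparseLists hb
  let p : (hypercube d).edgeSet → Fin d := fun e => (φ e).getD ⟨0, hdpos⟩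
  have hsep := hM.separatedPrecoloring (by omega) p
  suffices h : ∃ g : (Fin d → Bool) → Fin d → Fin d, IsProperColoring g ∧
      (∀ x i, (dirEdge x i : Sym2 (Fin d → Bool)) ∈ M.edgeSet → g x i = p (dirEdge x i)) ∧
      ∀ x i, g x i ∉ L (dirEdge x i) by
    obtain ⟨g, hg, hgp, hgL⟩ := h
    obtain ⟨f, hf⟩ := hg.exists_coloring
    refine ⟨f, fun e c hec => ?_, fun e => ?_⟩
    · obtain ⟨x, i, rfl⟩ := exists_dirEdge e
      rw [hf, hgp x i ((hφM _).1 (by simp [hec]))]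
      simp [p, hec]
    · obtain ⟨x, i, rfl⟩ := exists_dirEdge e
      rw [hf]
      exact hgL x i
  obtain hb0 | hbpos := Nat.eq_zero_or_pos (d / (300 * 4 ^ 100))
  · -- in small dimensions all lists are empty
    obtain ⟨g, hg, hgp⟩ := hsep.exists_extension
    refine ⟨g, hg, hgp, fun x i hx => ?_⟩
    have h1 := hl.card_le x i
    have h2 := Finset.card_pos.2 ⟨_, hx⟩
    omega
  · have hbd : 300 * 4 ^ 100 * (d / (300 * 4 ^ 100)) ≤ d := Nat.mul_div_le _ _
    obtain ⟨σ, hσ₁, hσ₂⟩ := hl.exists_perm hbd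
    refine hsep.exists_extension_avoiding hl (fun x i hx => ?_) hσ₁ hσ₂ (by omega)
    obtain ⟨c, hc⟩ := Option.ne_none_iff_exists'.1 ((hφM _).2 hx)
    have : p (dirEdge x i) = c := by simp [p, hc]
    rw [this]
    exact hφL _ _ hc
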